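/- Let $K$ be a field of characteristic $0$ and $S=K[x,y]$. Let $\mathcal A=\{H_1,\dots,H_n\}$ be a finite set of lines through the origin of $K^2$, $H_i=\ker\alpha_i$ with $\alpha_i$ a linear form. For $\mu\in\Lambda:=\mathbb N^{n}$ put $$D(\mathcal A,\mu)=\{\theta\in\operatorname{Der}_K(S)\mid \theta(\alpha_i)\in(\alpha_i^{\mu_i})\ \text{for all } i\}.$$ This is a graded free $S$-module of rank $2$; if $(d_1,d_2)$ are the polynomial degrees of a homogeneous basis, put $\Delta(\mu)=|d_1-d_2|$. (A derivation $\theta$ has polynomial degree $d$ if $\theta(x)$ and $\theta(y)$ are homogeneous of degree $d$.) Let $\Lambda'=\{\mu\in\Lambda\mid\Delta(\mu)>0\}$, regarded as an induced subgraph of the Hasse graph of $\Lambda$ with the componentwise order. For $\mu\in\Lambda$ and $r\in\mathbb N$ let $B(\mu,r)=\{\nu\in\Lambda\mid\sum_i|\mu_i-\nu_i|<r\}$. **Proposition 5.3.** Let $\mathcal A$ be either the Coxeter arrangement of type $B_2$, that is, the kernels of $x,\ y,\ x+y,\ x-y$, or, when $K$ contains a square root $\sqrt3$ of $3$, the Coxeter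 arrangement of type $G_2$, that is, the kernels of $x,\ x+\sqrt3y,\ x-\sqrt3y,\ y,\ \sqrt3x+y,\ \sqrt3x-y$. Let $k\ge 0$ be an integer and $\mu=(2k+1,\dots,2k+1)\in\Lambda$. Then $\mu$ is a maximum point of $\Delta$ on a finite connected component $C$ of $\Lambda'$. Moreover, $\mu$ is the only point of $C$ at which $\Delta|_C$ attains its maximum, and $C$ is the ball $B(\mu,\Delta(\mu))$. -/

import Mathlib

open MvPolynomial

noncomputable section

/-- A central arrangement in the plane `K²`: finitely many distinct lines through the origin,
`ι` being the index set of the lines. Each line `H i` is given together with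
a linear form `form i` in `S = K[x, y]` (`x = X 0`, `y = X 1`) whose kernel is `H i`. -/
structure PlaneArrangement (K : Type*) [Field K] (ι : Type*) where
  form : ι → MvPolynomial (Fin 2) K
  form_homogeneous : ∀ i, (form i).IsHomogeneous 1
  form_ne_zero : ∀ i, form i ≠ 0
  ker_injective : Function.Injective fun i => {v : Fin 2 → K | eval v (form i) = 0}

namespace PlaneArrangement

variable {K : Type*} [Field K] {ι : Type*}

/-- The derivation module `D(A, μ)`: the `K`-derivations `θ` of `S` such that `θ (α_H)` lies in
the ideal generated by `α_H ^ μ_H`, for every line `H`. -/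
def derModule (A : PlaneArrangement K ι) (μ : ι → ℕ) :
    Submodule (MvPolynomial (Fin 2) K)
      (Derivation K (MvPolynomial (Fin 2) K) (MvPolynomial (Fin 2) K)) where
  carrier := {θ | ∀ i, θ (A.form i) ∈ Ideal.span {A.form i ^ μ i}}
  add_mem' := fun {a b} ha hb i => by
    simpa using Ideal.add_mem _ (ha i) (hb i)
  zero_mem' := fun i => by simp
  smul_mem' := fun c θ h i => by
    simpa using Ideal.mul_mem_left _ c (h i)

/-- `θ = f ∂_x + g ∂_y` is homogeneous of polynomial degree `d` if `f = θ x` and `g = θ y` are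
homogeneous polynomials of degree `d`. -/
def IsHomogeneousDer (θ : Derivation K (MvPolynomial (Fin 2) K) (MvPolynomial (Fin 2) K))
    (d : ℕ) : Prop :=
  ∀ j : Fin 2, (θ (X j)).IsHomogeneous d

/-- `(d₁, d₂)` are the exponents of `(A, μ)`: the module `D(A, μ)` has a basis over `S`
consisting of two homogeneous derivations, of degrees `d₁` and `d₂`. -/
def HasExponents (A : PlaneArrangement K ι) (μ : ι → ℕ) (d₁ d₂ : ℕ) : Prop :=
  ∃ b : Module.Basis (Fin 2) (MvPolynomial (Fin 2) K) (A.derModule μ),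
    IsHomogeneousDer (b 0).1 d₁ ∧ IsHomogeneousDer (b 1).1 d₂

/-- `Δ(μ) = |d₁ - d₂|`, where `(d₁, d₂)` are the exponents of `(A, μ)`. The exponents exist
(`D(A, μ)` is a graded free module of rank two, as the plane is two-dimensional) and are unique
up to order, so that the set below consists of exactly one number. -/
def Delta (A : PlaneArrangement K ι) (μ : ι → ℕ) : ℕ :=
  sInf {n | ∃ d₁ d₂ : ℕ, A.HasExponents μ d₁ d₂ ∧ n = ((d₁ : ℤ) - d₂).natAbs}

/-- `Λ'`, the support of `Δ` in the multiplicity lattice `Λ = ι → ℕ`. -/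
def support (A : PlaneArrangement K ι) : Set (ι → ℕ) :=
  {μ | 0 < A.Delta μ}

/-- The maximal connected components of `Λ'`, as subsets of `Λ`. Here `Λ'` carries the graph
structure induced from the Hasse graph of `Λ` with its componentwise order. -/
def components (A : PlaneArrangement K ι) : Set (Set (ι → ℕ)) :=
  {C | ∃ c : ((SimpleGraph.hasse (ι → ℕ)).induce A.support).ConnectedComponent,
    C = Subtype.val '' c.supp}

/-- The finite maximal connected components of `Λ'`. -/
def finiteComponents (A : PlaneArrangement K ι) : Set (Set (ι → ℕ)) :=
  {C | C ∈ A.components ∧ C.Finite}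

/-- The points of `C` at which `Δ` attains its maximum over `C`. -/
def maxPoints (A : PlaneArrangement K ι) (C : Set (ι → ℕ)) : Set (ι → ℕ) :=
  {μ | μ ∈ C ∧ ∀ ν ∈ C, A.Delta ν ≤ A.Delta μ}

/-- The union, over all finite components `C` of `Λ'`, of the maximum points of `C`. -/
def allMaxPoints (A : PlaneArrangement K ι) : Set (ι → ℕ) :=
  ⋃ C ∈ A.finiteComponents, A.maxPoints C

end PlaneArrangement

/-- The distance `∑_H |μ_H - ν_H|` on the multiplicity lattice. -/
def multDist {ι : Type*} [Fintype ι] (μ ν : ι → ℕ) : ℕ :=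
  ∑ i, ((μ i : ℤ) - ν i).natAbs

/-- The ball `{ν | d(μ, ν) < r}` with center `μ` and radius `r` in the multiplicity lattice. -/
def multBall {ι : Type*} [Fintype ι] (μ : ι → ℕ) (r : ℕ) : Set (ι → ℕ) :=
  {ν | multDist μ ν < r}

/-- The Coxeter arrangement of type `B₂`: the kernels of `x`, `y`, `x + y`, `x - y`. -/
def coxeterB2 (K : Type*) [Field K] [CharZero K] : PlaneArrangement K (Fin 4) where
  form := ![X 0, X 1, X 0 + X 1, X 0 - X 1]
  form_homogeneous := by
    have h0 := isHomogeneous_X K (0 : Fin 2)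
    have h1 := isHomogeneous_X K (1 : Fin 2)
    intro i
    fin_cases i
    · exact h0
    · exact h1
    · exact h0.add h1
    · exact h0.sub h1
  form_ne_zero := by
    intro i h
    have h' := congrArg (eval ![(1 : K), 2]) h
    fin_cases i <;> norm_num at h'
  ker_injective := by
    intro i j h
    have h' := Set.ext_iff.1 h ((![![0, 1], ![1, 0], ![1, -1], ![1, 1]] : Fin 4 → Fin 2 → K) i)
    fin_cases i <;> fin_cases j <;> first | rfl | (exfalso; norm_num at h')

/-- The Coxeter arrangement of type `G₂`: the kernels of `x`, `x + √3 y`, `x - √3 y`, `y`,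
`√3 x + y`, `√3 x - y`, where `s` plays the role of `√3`. -/
def coxeterG2 (K : Type*) [Field K] [CharZero K] (s : K) (hs : s ^ 2 = 3) :
    PlaneArrangement K (Fin 6) where
  form := ![X 0, X 0 + C s * X 1, X 0 - C s * X 1, X 1, C s * X 0 + X 1, C s * X 0 - X 1]
  form_homogeneous := by
    have h0 := isHomogeneous_X K (0 : Fin 2)
    have h1 := isHomogeneous_X K (1 : Fin 2)
    intro i
    fin_cases i
    · exact h0
    · exact h0.add (h1.C_mul s)
    · exact h0.sub (h1.C_mul s)
    · exact h1
    · exact (h0.C_mul s).add h1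
    · exact (h0.C_mul s).sub h1
  form_ne_zero := by
    intro i h
    have hs0 : s ≠ 0 := by rintro rfl; norm_num at hs
    have h0 := congrArg (eval ![(1 : K), 0]) h
    have h1 := congrArg (eval ![(0 : K), 1]) h
    fin_cases i <;> simp [hs0] at h0 h1
  ker_injective := by
    have hs0 : s ≠ 0 := by rintro rfl; norm_num at hs
    have e1 : s * s = 3 := by rw [← hs]; ring
    intro i j h
    have h' := Set.ext_iff.1 h
      ((![![0, 1], ![s, -1], ![s, 1], ![1, 0], ![1, -s], ![1, s]] : Fin 6 → Fin 2 → K) i)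
    fin_cases i <;> fin_cases j <;> first | rfl | (exfalso; norm_num [e1, hs0] at h')

end

noncomputable section

/-! ### Homogeneous polynomials in two variables and linear forms. -/

section LinearForms

variable {K : Type*} [Field K]

/-! Everything follows from one derivation `θ` of degree `d` in `D(A, μ)` with coprime coefficients
and order exactly `μ_H` along each line (`IsCentral`). Write `|μ| = 2 * d + δ` and let `ν` be at
distance at most `δ` from `μ`. The determinant of `θ` and a basis element of `D(A, ν)` of least
degree is divisible by the product of the `α_H ^ min(μ_H, ν_H)`. Either this forces that element to
be, up to a constant, `θ` times the product of the `α_H ^ (ν_H - μ_H)` (truncated subtraction), or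
its degree is already half of `|ν|`. As the exponents sum to `|ν|`, in both cases `Δ(ν) = δ -
dist(μ, ν)`. So `Δ` is a cone over the ball of radius `δ` and vanishes on its boundary sphere, which
cuts the ball off as a component with its unique maximum at the center.

For the `m` mirrors of a dihedral group, `θ` has coefficients the real and imaginary parts of `z *
F(z ^ m, w ^ m)`, where `z = x + i y`, `w = x - i y` and `F` is a hypergeometric polynomial of
degree `k`. Along circles the coefficients solve a second order equation, singular exactly on the
mirrors, with local exponents `0` and `2 * k + 1`. The function `θ(α_H)` is a solution vanishing on
`H`, so it has order exactly `2 * k + 1` there. The Wronskian of the coefficients satisfies a first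
order equation, and this leaves no room for a common factor. Here `d = m * k + 1` and `δ = m - 2`,
with `m = 4` for `B₂` and `m = 6` for `G₂`. The unit `i` is adjoined formally even if `K` contains
one; divisibility by primes is tested on components in `S`. -/

theorem exists_eq_linear_of_isHomogeneous {p : MvPolynomial (Fin 2) K}
    (hp : p.IsHomogeneous 1) : ∃ a b : K, p = C a * X 0 + C b * X 1 := by
  have h := hp.sum_X_mul_pderiv
  have hc : ∀ i, ∃ a : K, pderiv i p = C a := fun i =>
    ⟨_, totalDegree_eq_zero_iff_eq_C.1 ((totalDegree_zero_iff_isHomogeneous _).2 hp.pderiv)⟩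
  obtain ⟨a, ha⟩ := hc 0
  obtain ⟨b, hb⟩ := hc 1
  refine ⟨a, b, ?_⟩
  rw [Fin.sum_univ_two, ha, hb, one_smul] at h
  rw [← h]; ring

theorem prime_of_isHomogeneous_one {p : MvPolynomial (Fin 2) K}
    (hp : p.IsHomogeneous 1) (h0 : p ≠ 0) : Prime p := by
  refine (irreducible_of_totalDegree_eq_one (hp.totalDegree h0) fun x hx => ?_).prime
  rw [isUnit_iff_ne_zero]
  rintro rfl
  exact h0 (MvPolynomial.ext _ _ fun i => by simpa using hx i)

/-- The cofactor of a homogeneous polynomial in a homogeneous polynomial can be taken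
homogeneous. -/
theorem exists_isHomogeneous_cofactor {p q : MvPolynomial (Fin 2) K}
    {m d : ℕ} (hp : p.IsHomogeneous m) (hq : q.IsHomogeneous d) (hmd : m ≤ d) (h : p ∣ q) :
    ∃ g : MvPolynomial (Fin 2) K, g.IsHomogeneous (d - m) ∧ q = p * g := by
  obtain ⟨g, rfl⟩ := h
  refine ⟨homogeneousComponent (d - m) g, homogeneousComponent_isHomogeneous _ _, ?_⟩
  have key : homogeneousComponent d (p * g) = p * homogeneousComponent (d - m) g := by
    conv_lhs => rw [← sum_homogeneousComponent g, Finset.mul_sum, map_sum]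
    have : ∀ i, homogeneousComponent d (p * homogeneousComponent i g)
        = if i = d - m then p * homogeneousComponent (d - m) g else 0 := by
      intro i
      rw [homogeneousComponent_of_mem (hp.mul (homogeneousComponent_isHomogeneous i g))]
      by_cases hi : i = d - m
      · subst hi; rw [if_pos (by omega), if_pos rfl]
      · rw [if_neg (by omega), if_neg hi]
    simp_rw [this]
    rw [Finset.sum_ite_eq']
    split_ifs with hmem
    · rfl
    · rw [homogeneousComponent_eq_zero _ _ (by simp at hmem; omega), mul_zero]
  rw [← key, homogeneousComponent_eq_self hq]

theorem eq_zero_of_isHomogeneous_dvd {p q : MvPolynomial (Fin 2) K}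
    {m d : ℕ} (hp : p.IsHomogeneous m) (hq : q.IsHomogeneous d) (hdm : d < m) (h : p ∣ q) :
    q = 0 := by
  obtain ⟨g, rfl⟩ := h
  by_contra h0
  have hp0 : p ≠ 0 := left_ne_zero_of_mul h0
  have := totalDegree_mul_of_isDomain hp0 (right_ne_zero_of_mul h0)
  rw [hq.totalDegree h0, hp.totalDegree hp0] at this
  omega

theorem aeval_mul_of_isHomogeneous {p : MvPolynomial (Fin 2) K} {n : ℕ}
    (hp : p.IsHomogeneous n) {A : Type*} [CommRing A] [Algebra K A] (t : A) (v : Fin 2 → A) :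
    aeval (fun i => t * v i) p = t ^ n * aeval v p := by
  rw [aeval_def, aeval_def, eval₂_eq', eval₂_eq', Finset.mul_sum]
  refine Finset.sum_congr rfl fun d hd => ?_
  have hdeg := hp.degree_eq_sum_deg_support hd
  rw [Finset.sum_subset (Finset.subset_univ _) (by simp), Fin.sum_univ_two] at hdeg
  simp only [Fin.prod_univ_two, mul_pow]
  rw [hdeg]; ring

/-- A homogeneous polynomial vanishing at a nonzero point of a line is divisible by the form of
the line. -/
theorem linear_dvd_of_eval_eq_zero {p : MvPolynomial (Fin 2) K} {n : ℕ}
    (hp : p.IsHomogeneous n) {a b : K} (hab : C a * X 0 + C b * X 1 ≠ (0 : MvPolynomial (Fin 2) K))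
    (h : eval ![b, -a] p = 0) : C a * X 0 + C b * X 1 ∣ p := by
  set α : MvPolynomial (Fin 2) K := C a * X 0 + C b * X 1 with hα
  -- Modulo `α` the coordinates, scaled by a unit `c`, are a multiple `ℓ` of the point `t`; by
  -- homogeneity `c ^ n * p` becomes `ℓ ^ n * p(t) = 0`.
  have key : ∀ (t : Fin 2 → MvPolynomial (Fin 2) K) (c : K) (_ : c ≠ 0)
      (ℓ : MvPolynomial (Fin 2) K),
      (∀ i, α ∣ C c * X i - ℓ * t i) → aeval t p = 0 → α ∣ p := by
    intro t c hc ℓ ht h0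
    let π := Ideal.Quotient.mkₐ K (Ideal.span {α})
    have h1 : π (C c ^ n * p) = 0 := by
      have e1 : C c ^ n * p = aeval (fun i => C c * X i) p := by
        rw [aeval_mul_of_isHomogeneous hp, aeval_X_left_apply]
      have e2 : π (aeval (fun i => C c * X i) p) = π (aeval (fun i => ℓ * t i) p) := by
        rw [← AlgHom.comp_apply, ← AlgHom.comp_apply]
        congr 1
        ext i
        simp only [AlgHom.comp_apply, aeval_X]
        exact Ideal.Quotient.eq.2 (Ideal.mem_span_singleton.2 (ht i))
      rw [e1, e2, aeval_mul_of_isHomogeneous hp, h0, mul_zero, map_zero]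
    have h2 : α ∣ C c ^ n * p := Ideal.mem_span_singleton.1 (Ideal.Quotient.eq_zero_iff_mem.1 h1)
    have hu : IsUnit (C c ^ n : MvPolynomial (Fin 2) K) :=
      ((isUnit_iff_ne_zero.2 hc).map C).pow n
    exact (hu.dvd_mul_left).1 h2
  have hev : aeval (fun i => C ((![b, -a] : Fin 2 → K) i)) p = (0 : MvPolynomial (Fin 2) K) := by
    have : aeval (fun i => (C ((![b, -a] : Fin 2 → K) i) : MvPolynomial (Fin 2) K)) p
        = C (eval ![b, -a] p) := by
      rw [← coe_aeval_eq_eval, RingHom.coe_coe, ← algebraMap_eq]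
      exact MvPolynomial.aeval_algebraMap_apply _ _ p
    rw [this, h, C_0]
  by_cases hb : b = 0
  · have ha : a ≠ 0 := by rintro rfl; apply hab; simp [hα, hb]
    refine key _ a ha (-X 1) (fun i => ?_) hev
    fin_cases i
    · exact ⟨1, by simp [hα, hb]⟩
    · simp; ring_nf; simp
  · refine key _ b hb (X 0) (fun i => ?_) hev
    fin_cases i
    · simp; ring_nf; simp
    · exact ⟨1, by simp [hα]; ring⟩

end LinearForms

/-- Derivations of the coordinate ring of the plane. -/
abbrev PlaneDer (K : Type*) [Field K] :=
  Derivation K (MvPolynomial (Fin 2) K) (MvPolynomial (Fin 2) K)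

theorem exists_basis_of_pair {R M : Type*} [CommRing R] [AddCommGroup M] [Module R M] (x y : M)
    (hli : ∀ s t : R, s • x + t • y = 0 → s = 0 ∧ t = 0)
    (hsp : ∀ z : M, ∃ p q : R, z = p • x + q • y) :
    ∃ b : Module.Basis (Fin 2) R M, b 0 = x ∧ b 1 = y := by
  have hsp' : ⊤ ≤ Submodule.span R (Set.range ![x, y]) := by
    rintro z -
    obtain ⟨p, q, rfl⟩ := hsp z
    exact add_mem (Submodule.smul_mem _ _ (Submodule.subset_span ⟨0, rfl⟩))
      (Submodule.smul_mem _ _ (Submodule.subset_span ⟨1, rfl⟩))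
  refine ⟨Module.Basis.mk (LinearIndependent.pair_iff.2 hli) hsp', ?_, ?_⟩
  · rw [Module.Basis.mk_apply]; rfl
  · rw [Module.Basis.mk_apply]; rfl

/-! ### Determinants of pairs of derivations. -/

section Wedge

variable {K : Type*} [Field K]

/-- The determinant of the coefficients of two derivations. -/
def wedge (θ φ : PlaneDer K) : MvPolynomial (Fin 2) K :=
  θ (X 0) * φ (X 1) - θ (X 1) * φ (X 0)

theorem planeDer_ext {θ φ : PlaneDer K} (h0 : θ (X 0) = φ (X 0)) (h1 : θ (X 1) = φ (X 1)) :
    θ = φ := by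
  refine MvPolynomial.derivation_ext fun i => ?_
  fin_cases i
  · exact h0
  · exact h1

theorem planeDer_linear (θ : PlaneDer K) (a b : K) :
    θ (C a * X 0 + C b * X 1) = C a * θ (X 0) + C b * θ (X 1) := by
  simp only [map_add, Derivation.leibniz, derivation_C, smul_eq_mul, mul_zero, add_zero]

theorem planeDer_isHomogeneous {θ : PlaneDer K} {d : ℕ}
    (h : PlaneArrangement.IsHomogeneousDer θ d) (a b : K) :
    (θ (C a * X 0 + C b * X 1)).IsHomogeneous d := by
  rw [planeDer_linear]
  exact ((h 0).C_mul a).add ((h 1).C_mul b)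

theorem wedge_isHomogeneous {θ φ : PlaneDer K} {d e : ℕ}
    (hθ : PlaneArrangement.IsHomogeneousDer θ d) (hφ : PlaneArrangement.IsHomogeneousDer φ e) :
    (wedge θ φ).IsHomogeneous (d + e) :=
  ((hθ 0).mul (hφ 1)).sub ((hθ 1).mul (hφ 0))

/-- Replacing a coordinate by `α = a x + b y` in the determinant multiplies it by `a` or `b` up to
sign, and one of these is a unit. -/
theorem dvd_wedge {a b : K} (hab : C a * X 0 + C b * X 1 ≠ (0 : MvPolynomial (Fin 2) K))
    {p : MvPolynomial (Fin 2) K} {θ φ : PlaneDer K} (hθ : p ∣ θ (C a * X 0 + C b * X 1))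
    (hφ : p ∣ φ (C a * X 0 + C b * X 1)) : p ∣ wedge θ φ := by
  rw [planeDer_linear] at hθ hφ
  have h0 : p ∣ C a * wedge θ φ := by
    have := (hθ.mul_left (φ (X 1))).sub (hφ.mul_left (θ (X 1)))
    convert this using 1; rw [wedge]; ring
  have h1 : p ∣ C b * wedge θ φ := by
    have := (hφ.mul_left (θ (X 0))).sub (hθ.mul_left (φ (X 0)))
    convert this using 1; rw [wedge]; ring
  by_cases ha : a = 0
  · have hb : b ≠ 0 := by rintro rfl; apply hab; simp [ha]
    exact ((isUnit_iff_ne_zero.2 hb).map C).dvd_mul_left.1 h1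
  · exact ((isUnit_iff_ne_zero.2 ha).map C).dvd_mul_left.1 h0

/-- Cramer's rule. -/
theorem wedge_smul_eq (θ φ ψ : PlaneDer K) :
    wedge θ φ • ψ = wedge ψ φ • θ + wedge θ ψ • φ := by
  apply planeDer_ext <;>
  · simp only [Derivation.add_apply, Derivation.smul_apply, smul_eq_mul, wedge]; ring

theorem wedge_combination (θ φ : PlaneDer K) (p q r s : MvPolynomial (Fin 2) K) :
    wedge (p • θ + q • φ) (r • θ + s • φ) = (p * s - q * r) * wedge θ φ := by
  simp only [Derivation.add_apply, Derivation.smul_apply, smul_eq_mul, wedge]; ring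

end Wedge

/-! ### Derivation modules, Saito's criterion and existence of exponents. -/

namespace PlaneArrangement

variable {K : Type*} [Field K] {ι : Type*} (A : PlaneArrangement K ι)

theorem mem_derModule {μ : ι → ℕ} {θ : PlaneDer K} :
    θ ∈ A.derModule μ ↔ ∀ i, A.form i ^ μ i ∣ θ (A.form i) :=
  forall_congr' fun _ => Ideal.mem_span_singleton

theorem form_prime (i : ι) : Prime (A.form i) :=
  prime_of_isHomogeneous_one (A.form_homogeneous i) (A.form_ne_zero i)

theorem form_not_dvd {i j : ι} (hij : i ≠ j) : ¬ A.form i ∣ A.form j := by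
  intro h
  obtain ⟨u, hu⟩ := (A.form_prime i).associated_of_dvd (A.form_prime j) h
  obtain ⟨c, hc, hcu⟩ := isUnit_iff_eq_C_of_isReduced.1 u.isUnit
  refine hij (A.ker_injective ?_)
  ext v
  simp only [Set.mem_ofPred_eq]
  rw [← hu, hcu, eval_mul, eval_C, mul_eq_zero, or_iff_left hc.ne_zero]

theorem form_isRelPrime {i j : ι} (hij : i ≠ j) : IsRelPrime (A.form i) (A.form j) :=
  (A.form_prime i).irreducible.isRelPrime_iff_not_dvd.2 (A.form_not_dvd hij)

theorem form_pow_dvd_wedge {i : ι} {n : ℕ} {θ φ : PlaneDer K}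
    (hθ : A.form i ^ n ∣ θ (A.form i)) (hφ : A.form i ^ n ∣ φ (A.form i)) :
    A.form i ^ n ∣ wedge θ φ := by
  obtain ⟨a, b, hab⟩ := exists_eq_linear_of_isHomogeneous (A.form_homogeneous i)
  have h0 := A.form_ne_zero i
  rw [hab] at h0
  refine dvd_wedge h0 ?_ ?_
  · rwa [← hab]
  · rwa [← hab]

theorem derModule_anti {μ ν : ι → ℕ} (h : μ ≤ ν) {θ : PlaneDer K} (hθ : θ ∈ A.derModule ν) :
    θ ∈ A.derModule μ :=
  A.mem_derModule.2 fun i => (pow_dvd_pow _ (h i)).trans (A.mem_derModule.1 hθ i)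

theorem mem_derModule_update [DecidableEq ι] {μ : ι → ℕ} {i : ι} {θ : PlaneDer K}
    (hθ : θ ∈ A.derModule μ) (hi : A.form i ^ (μ i + 1) ∣ θ (A.form i)) :
    θ ∈ A.derModule (Function.update μ i (μ i + 1)) := by
  refine A.mem_derModule.2 fun j => ?_
  by_cases hj : j = i
  · subst hj; rwa [Function.update_self]
  · rw [Function.update_of_ne hj]; exact A.mem_derModule.1 hθ j

theorem isHomogeneousDer_form_smul {i : ι} {θ : PlaneDer K} {d : ℕ} (h : IsHomogeneousDer θ d) :
    IsHomogeneousDer (A.form i • θ) (d + 1) := fun j => by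
  rw [Derivation.smul_apply, smul_eq_mul, add_comm]
  exact (A.form_homogeneous i).mul (h j)

variable {A} in
theorem exists_eq_combination {μ : ι → ℕ}
    (b : Module.Basis (Fin 2) (MvPolynomial (Fin 2) K) (A.derModule μ)) {ψ : PlaneDer K}
    (hψ : ψ ∈ A.derModule μ) :
    ∃ p q : MvPolynomial (Fin 2) K, ψ = p • (b 0).1 + q • (b 1).1 := by
  refine ⟨b.repr ⟨ψ, hψ⟩ 0, b.repr ⟨ψ, hψ⟩ 1, ?_⟩
  have := congrArg Subtype.val (b.sum_repr ⟨ψ, hψ⟩)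
  rw [Fin.sum_univ_two] at this
  exact this.symm

theorem form_smul_mem_derModule_update [DecidableEq ι] {μ : ι → ℕ} {i : ι} {θ : PlaneDer K}
    (hθ : θ ∈ A.derModule μ) :
    A.form i • θ ∈ A.derModule (Function.update μ i (μ i + 1)) := by
  refine A.mem_derModule_update (Submodule.smul_mem _ _ hθ) ?_
  rw [Derivation.smul_apply, smul_eq_mul, pow_succ']
  exact mul_dvd_mul_left _ (A.mem_derModule.1 hθ i)

variable [Fintype ι]

/-- The product of the forms of the lines, raised to the given multiplicities. -/
def formProd (μ : ι → ℕ) : MvPolynomial (Fin 2) K := ∏ i, A.form i ^ μ i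

theorem formProd_ne_zero (μ : ι → ℕ) : A.formProd μ ≠ 0 :=
  Finset.prod_ne_zero_iff.2 fun i _ => pow_ne_zero _ (A.form_ne_zero i)

theorem formProd_isHomogeneous (μ : ι → ℕ) : (A.formProd μ).IsHomogeneous (∑ i, μ i) := by
  refine IsHomogeneous.prod _ _ _ fun i _ => ?_
  simpa using (A.form_homogeneous i).pow (μ i)

theorem formProd_dvd {μ : ι → ℕ} {p : MvPolynomial (Fin 2) K} (h : ∀ i, A.form i ^ μ i ∣ p) :
    A.formProd μ ∣ p :=
  Finset.prod_dvd_of_isRelPrime (fun _ _ _ _ hij => (A.form_isRelPrime hij).pow)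
    fun i _ => h i

theorem formProd_dvd_wedge {μ : ι → ℕ} {θ φ : PlaneDer K} (hθ : θ ∈ A.derModule μ)
    (hφ : φ ∈ A.derModule μ) : A.formProd μ ∣ wedge θ φ :=
  A.formProd_dvd fun i =>
    A.form_pow_dvd_wedge (A.mem_derModule.1 hθ i) (A.mem_derModule.1 hφ i)

/-- Saito's criterion: two elements of `D(A, μ)` whose determinant is a nonzero multiple of the
product of the forms with multiplicities are a basis. -/
theorem hasExponents_of_wedge {μ : ι → ℕ} {θ φ : PlaneDer K} {d e : ℕ} (hθ : θ ∈ A.derModule μ)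
    (hφ : φ ∈ A.derModule μ) (hd : IsHomogeneousDer θ d) (he : IsHomogeneousDer φ e) {c : K}
    (hc : c ≠ 0) (hw : wedge θ φ = C c * A.formProd μ) : A.HasExponents μ d e := by
  have hw0 : wedge θ φ ≠ 0 := by
    rw [hw]; exact mul_ne_zero (by simpa using hc) (A.formProd_ne_zero μ)
  have hdvd : ∀ {ψ χ : PlaneDer K}, ψ ∈ A.derModule μ → χ ∈ A.derModule μ →
      wedge θ φ ∣ wedge ψ χ := fun hψ hχ => by
    rw [hw]
    exact ((isUnit_iff_ne_zero.2 hc).map C).mul_left_dvd.2 (A.formProd_dvd_wedge hψ hχ)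
  obtain ⟨b, hb0, hb1⟩ := exists_basis_of_pair
    (R := MvPolynomial (Fin 2) K) (⟨θ, hθ⟩ : A.derModule μ) ⟨φ, hφ⟩
    (fun s t hst => by
      have hst' : s • θ + t • φ = 0 := congrArg Subtype.val hst
      have h1 := wedge_combination θ φ s t 0 1
      have h2 := wedge_combination θ φ 1 0 s t
      rw [hst'] at h1 h2
      simp only [mul_one, mul_zero, sub_zero, one_mul, zero_mul] at h1 h2
      have z1 : ∀ ψ : PlaneDer K, wedge 0 ψ = 0 := fun ψ => by simp [wedge]
      have z2 : ∀ ψ : PlaneDer K, wedge ψ 0 = 0 := fun ψ => by simp [wedge]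
      rw [z1] at h1; rw [z2] at h2
      exact ⟨(mul_eq_zero.1 h1.symm).resolve_right hw0, (mul_eq_zero.1 h2.symm).resolve_right hw0⟩)
    (fun ⟨ψ, hψ⟩ => by
      obtain ⟨p, hp⟩ := hdvd hψ hφ
      obtain ⟨q, hq⟩ := hdvd hθ hψ
      have hs := wedge_smul_eq θ φ ψ
      rw [hp, hq, mul_smul, mul_smul, ← smul_add] at hs
      refine ⟨p, q, Subtype.ext (planeDer_ext ?_ ?_)⟩
      · exact mul_left_cancel₀ hw0 (congrArg (fun D : PlaneDer K => D (X 0)) hs)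
      · exact mul_left_cancel₀ hw0 (congrArg (fun D : PlaneDer K => D (X 1)) hs))
  refine ⟨b, ?_, ?_⟩
  · rw [hb0]; exact hd
  · rw [hb1]; exact he

/-- The data entering Saito's criterion. -/
def IsSaitoPair (μ : ι → ℕ) (θ φ : PlaneDer K) (d e : ℕ) : Prop :=
  (θ ∈ A.derModule μ ∧ IsHomogeneousDer θ d) ∧ (φ ∈ A.derModule μ ∧ IsHomogeneousDer φ e) ∧
    ∃ c : K, c ≠ 0 ∧ wedge θ φ = C c * A.formProd μ

variable {A}

theorem IsSaitoPair.symm {μ : ι → ℕ} {θ φ : PlaneDer K} {d e : ℕ}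
    (h : A.IsSaitoPair μ θ φ d e) : A.IsSaitoPair μ φ θ e d := by
  obtain ⟨h1, h2, c, hc, hw⟩ := h
  refine ⟨h2, h1, -c, neg_ne_zero.2 hc, ?_⟩
  rw [C_neg, neg_mul, ← hw, wedge, wedge]; ring

theorem IsSaitoPair.hasExponents {μ : ι → ℕ} {θ φ : PlaneDer K} {d e : ℕ}
    (h : A.IsSaitoPair μ θ φ d e) : A.HasExponents μ d e := by
  obtain ⟨h1, h2, c, hc, hw⟩ := h
  exact A.hasExponents_of_wedge h1.1 h2.1 h1.2 h2.2 hc hw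

variable (A)

theorem formProd_update [DecidableEq ι] (μ : ι → ℕ) (i : ι) :
    A.formProd (Function.update μ i (μ i + 1)) = A.form i * A.formProd μ := by
  rw [formProd, formProd, ← Finset.mul_prod_erase _ _ (Finset.mem_univ i),
    ← Finset.mul_prod_erase _ (fun j => A.form j ^ μ j) (Finset.mem_univ i),
    Function.update_self, pow_succ]
  rw [Finset.prod_congr rfl fun j hj => by
    rw [Function.update_of_ne (Finset.ne_of_mem_erase hj)]]
  ring

theorem isSaitoPair_update_of_dvd [DecidableEq ι] {μ : ι → ℕ} {i : ι} {θ φ : PlaneDer K}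
    {d e : ℕ} (h : A.IsSaitoPair μ θ φ d e) (hi : A.form i ^ (μ i + 1) ∣ θ (A.form i)) :
    A.IsSaitoPair (Function.update μ i (μ i + 1)) θ (A.form i • φ) d (e + 1) := by
  obtain ⟨h1, h2, c, hc, hw⟩ := h
  refine ⟨⟨A.mem_derModule_update h1.1 hi, h1.2⟩, ⟨A.form_smul_mem_derModule_update h2.1,
    A.isHomogeneousDer_form_smul h2.2⟩, c, hc, ?_⟩
  rw [formProd_update, mul_left_comm, ← hw]
  simp only [Derivation.smul_apply, smul_eq_mul, wedge]; ring

/-- If the element `θ` of smaller degree does not gain an order along the line, then its cofactor is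
nonzero there, and a homogeneous multiple of `θ` can be subtracted from `φ` so that `φ` gains one.
The bound `d ≤ e` makes room for the multiplier of degree `e - d`. -/
theorem exists_isSaitoPair_update [DecidableEq ι] {μ : ι → ℕ} (i : ι) {θ φ : PlaneDer K}
    {d e : ℕ} (hde : d ≤ e) (h : A.IsSaitoPair μ θ φ d e) :
    ∃ θ' φ' d' e', A.IsSaitoPair (Function.update μ i (μ i + 1)) θ' φ' d' e' := by
  by_cases hi : A.form i ^ (μ i + 1) ∣ θ (A.form i)
  · exact ⟨_, _, _, _, A.isSaitoPair_update_of_dvd h hi⟩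
  obtain ⟨⟨hθ, hd⟩, ⟨hφ, he⟩, c, hc, hw⟩ := h
  obtain ⟨a, b, hab⟩ := exists_eq_linear_of_isHomogeneous (A.form_homogeneous i)
  have h0 := A.form_ne_zero i
  have hpow : (A.form i ^ μ i).IsHomogeneous (μ i) := by
    simpa using (A.form_homogeneous i).pow (μ i)
  have hθd : (θ (A.form i)).IsHomogeneous d := by
    rw [hab]; exact planeDer_isHomogeneous hd a b
  have hφd : (φ (A.form i)).IsHomogeneous e := by
    rw [hab]; exact planeDer_isHomogeneous he a b
  have hmd : μ i ≤ d := by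
    by_contra hlt
    apply hi
    rw [eq_zero_of_isHomogeneous_dvd hpow hθd (not_le.1 hlt) (A.mem_derModule.1 hθ i)]
    exact dvd_zero _
  obtain ⟨g, hg, hθg⟩ := exists_isHomogeneous_cofactor hpow hθd hmd (A.mem_derModule.1 hθ i)
  obtain ⟨g', hg', hφg⟩ :=
    exists_isHomogeneous_cofactor hpow hφd (hmd.trans hde) (A.mem_derModule.1 hφ i)
  have hgi : ¬ A.form i ∣ g := by
    rintro ⟨t, rfl⟩
    apply hi
    rw [hθg, pow_succ]
    exact mul_dvd_mul_left _ (Dvd.intro _ rfl)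
  -- The point `(b, -a)` spans the line. Powers of `ℓ` take the value `1` there, so they adjust the
  -- degree of the multiplier without changing its value.
  obtain ⟨ℓ, hℓ, hℓv⟩ : ∃ ℓ : MvPolynomial (Fin 2) K, ℓ.IsHomogeneous 1 ∧
      eval ![b, -a] ℓ = 1 := by
    by_cases hb : b = 0
    · have ha : a ≠ 0 := by rintro rfl; apply h0; simp [hab, hb]
      refine ⟨C (-a)⁻¹ * X 1, (isHomogeneous_X K 1).C_mul _, ?_⟩
      rw [eval_mul, eval_C, eval_X]
      exact inv_mul_cancel₀ (neg_ne_zero.2 ha)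
    · refine ⟨C b⁻¹ * X 0, (isHomogeneous_X K 0).C_mul _, ?_⟩
      simp [hb]
  have hgv : eval ![b, -a] g ≠ 0 := fun hz => hgi (by
    rw [hab] at h0 ⊢; exact linear_dvd_of_eval_eq_zero hg h0 hz)
  set q : MvPolynomial (Fin 2) K := C (eval ![b, -a] g' / eval ![b, -a] g) * ℓ ^ (e - d) with hq
  have hqh : q.IsHomogeneous (e - d) := by
    have := (hℓ.pow (e - d)).C_mul (eval ![b, -a] g' / eval ![b, -a] g)
    rwa [one_mul] at this
  have hdv : A.form i ∣ g' - q * g := by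
    rw [hab] at h0 ⊢
    refine linear_dvd_of_eval_eq_zero (n := e - μ i) (hg'.sub ?_) h0 ?_
    · have := hqh.mul hg
      rwa [show e - d + (d - μ i) = e - μ i by omega] at this
    · rw [eval_sub, eval_mul, hq, eval_mul, eval_C, eval_pow, hℓv, one_pow, mul_one,
        div_mul_cancel₀ _ hgv, sub_self]
  have hpair : A.IsSaitoPair μ (φ - q • θ) θ e d := by
    refine ⟨⟨sub_mem hφ (Submodule.smul_mem _ _ hθ), fun j => ?_⟩, ⟨hθ, hd⟩, -c,
      neg_ne_zero.2 hc, ?_⟩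
    · rw [Derivation.sub_apply, Derivation.smul_apply, smul_eq_mul]
      refine (he j).sub ?_
      have := hqh.mul (hd j)
      rwa [show e - d + d = e by omega] at this
    · rw [C_neg, neg_mul, ← hw]
      simp only [Derivation.sub_apply, Derivation.smul_apply, smul_eq_mul, wedge]; ring
  refine ⟨_, _, _, _, A.isSaitoPair_update_of_dvd hpair ?_⟩
  rw [Derivation.sub_apply, Derivation.smul_apply, smul_eq_mul, hθg, hφg, mul_left_comm,
    ← mul_sub, pow_succ]
  exact mul_dvd_mul_left _ hdv

/-- Induction on the total multiplicity, from `∂_x, ∂_y` at multiplicity zero. -/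
theorem exists_isSaitoPair (μ : ι → ℕ) : ∃ θ φ d e, A.IsSaitoPair μ θ φ d e := by
  classical
  induction hn : ∑ i, μ i generalizing μ with
  | zero =>
    have hμ : ∀ i, μ i = 0 := fun i => (Finset.sum_eq_zero_iff.1 hn) i (Finset.mem_univ i)
    have hmem : ∀ θ : PlaneDer K, θ ∈ A.derModule μ := fun θ =>
      A.mem_derModule.2 fun i => by rw [hμ i, pow_zero]; exact one_dvd _
    refine ⟨pderiv 0, pderiv 1, 0, 0, ⟨hmem _, fun j => ?_⟩, ⟨hmem _, fun j => ?_⟩, 1,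
      one_ne_zero, ?_⟩
    · simpa using (isHomogeneous_X K j).pderiv (i := 0)
    · simpa using (isHomogeneous_X K j).pderiv (i := 1)
    · simp [wedge, formProd, hμ, pderiv_X]
  | succ n ih =>
    obtain ⟨i, hi⟩ : ∃ i, μ i ≠ 0 := by
      by_contra! h
      simp [h] at hn
    have hup : μ = Function.update (Function.update μ i (μ i - 1)) i
        ((Function.update μ i (μ i - 1)) i + 1) := by
      rw [Function.update_self, Function.update_idem, Nat.sub_add_cancel (by omega),
        Function.update_eq_self]
    have hsum : ∑ j, Function.update μ i (μ i - 1) j = n := by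
      have h1 := Finset.sum_update_of_mem (Finset.mem_univ i) μ (μ i - 1)
      have h2 := Finset.sum_update_of_mem (Finset.mem_univ i) μ (μ i)
      rw [Function.update_eq_self] at h2
      omega
    obtain ⟨θ, φ, d, e, h⟩ := ih _ hsum
    rw [hup]
    rcases le_total d e with hde | hde
    · exact A.exists_isSaitoPair_update i hde h
    · exact A.exists_isSaitoPair_update i hde h.symm

theorem exists_hasExponents (μ : ι → ℕ) : ∃ d e, A.HasExponents μ d e := by
  obtain ⟨_, _, d, e, h⟩ := A.exists_isSaitoPair μ
  exact ⟨d, e, h.hasExponents⟩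

variable {A}

/-- The exponents of a multiarrangement sum up to the total multiplicity. -/
theorem degree_add_eq {μ : ι → ℕ}
    (b : Module.Basis (Fin 2) (MvPolynomial (Fin 2) K) (A.derModule μ)) {d e : ℕ}
    (hd : IsHomogeneousDer (b 0).1 d) (he : IsHomogeneousDer (b 1).1 e) :
    d + e = ∑ i, μ i := by
  obtain ⟨θ, φ, d', e', ⟨hθ, -⟩, ⟨hφ, -⟩, c, hc, hw⟩ := A.exists_isSaitoPair μ
  obtain ⟨p, q, rfl⟩ := exists_eq_combination b hθ
  obtain ⟨r, s, rfl⟩ := exists_eq_combination b hφ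
  rw [wedge_combination] at hw
  have hfp := A.formProd_isHomogeneous μ
  have hf0 := A.formProd_ne_zero μ
  have hww := wedge_isHomogeneous hd he
  have hcf0 : C c * A.formProd μ ≠ 0 := mul_ne_zero (by simpa using hc) hf0
  have hw0 : wedge (b 0).1 (b 1).1 ≠ 0 := by
    intro h0; rw [h0, mul_zero] at hw; exact hcf0 hw.symm
  -- The determinant of the basis divides that of a Saito pair, and is itself divisible by the
  -- product of the forms; both have degree `|μ|`.
  apply le_antisymm
  · by_contra hlt
    exact hcf0 (eq_zero_of_isHomogeneous_dvd hww (hfp.C_mul c) (not_le.1 hlt)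
      (Dvd.intro_left _ hw))
  · by_contra hlt
    exact hw0 (eq_zero_of_isHomogeneous_dvd hfp hww (not_le.1 hlt)
      (A.formProd_dvd_wedge (b 0).2 (b 1).2))

end PlaneArrangement

theorem exists_common_factor_of_isRelPrime {R : Type*} [CommRing R] [IsDomain R]
    [DecompositionMonoid R] {x y u v : R} (hxy : IsRelPrime x y) (h : u * y = v * x) :
    ∃ p, u = p * x ∧ v = p * y := by
  by_cases hx : x = 0
  · subst hx
    obtain ⟨w, rfl⟩ : IsUnit y := isRelPrime_zero_left.1 hxy
    have hu : u = 0 := by simpa using h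
    exact ⟨v * ↑w⁻¹, by simp [hu], by simp⟩
  · obtain ⟨p, rfl⟩ := hxy.dvd_of_dvd_mul_right (Dvd.intro_left v h.symm)
    exact ⟨p, mul_comm _ _, mul_left_cancel₀ hx (by rw [mul_comm x v, ← h]; ring)⟩

/-! ### Exponents near a central derivation. -/

namespace PlaneArrangement

variable {K : Type*} [Field K] {ι : Type*} {A : PlaneArrangement K ι}

theorem HasExponents.symm {μ : ι → ℕ} {d e : ℕ} (h : A.HasExponents μ d e) :
    A.HasExponents μ e d := by
  obtain ⟨b, h0, h1⟩ := h
  refine ⟨b.reindex (Equiv.swap 0 1), ?_, ?_⟩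
  · rw [Module.Basis.reindex_apply]; simpa using h1
  · rw [Module.Basis.reindex_apply]; simpa using h0

variable [Fintype ι]

/-- If `θ ∈ D(A, μ)` has coprime coefficients and the orders of `θ (α_H)` along `H` are exactly
`μ_H`, then all elements of `D(A, ν)` of small degree are multiples of `θ`. -/
theorem eq_smul_of_degree_lt {μ ν : ι → ℕ} {θ ψ : PlaneDer K} {d e : ℕ}
    (hθ : θ ∈ A.derModule μ) (hd : IsHomogeneousDer θ d)
    (hcop : IsRelPrime (θ (X 0)) (θ (X 1)))
    (hex : ∀ i, ¬ A.form i ^ (μ i + 1) ∣ θ (A.form i))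
    (hψ : ψ ∈ A.derModule ν) (he : IsHomogeneousDer ψ e)
    (hlt : e + d < ∑ i, min (μ i) (ν i)) :
    ∃ p : MvPolynomial (Fin 2) K, ψ = (p * A.formProd fun i => ν i - μ i) • θ := by
  have hw : wedge ψ θ = 0 := by
    refine eq_zero_of_isHomogeneous_dvd (A.formProd_isHomogeneous fun i => min (μ i) (ν i))
      (wedge_isHomogeneous he hd) hlt (A.formProd_dvd_wedge ?_ ?_)
    · exact A.derModule_anti (fun i => min_le_right _ _) hψ
    · exact A.derModule_anti (fun i => min_le_left _ _) hθ
  obtain ⟨p, h0, h1⟩ := exists_common_factor_of_isRelPrime hcop (sub_eq_zero.1 hw)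
  have hp : ψ = p • θ := planeDer_ext h0 h1
  -- Since the order of `θ (α_H)` is exactly `μ_H`, the missing `ν_H - μ_H` factors of `α_H` must
  -- come from `p`.
  have hdvd : A.formProd (fun i => ν i - μ i) ∣ p := by
    refine A.formProd_dvd fun i => ?_
    obtain ⟨g, hg⟩ := A.mem_derModule.1 hθ i
    have hgi : ¬ A.form i ∣ g := by
      rintro ⟨t, rfl⟩
      apply hex i
      rw [hg, pow_succ]
      exact mul_dvd_mul_left _ (Dvd.intro _ rfl)
    rcases le_total (ν i) (μ i) with hle | hle
    · rw [Nat.sub_eq_zero_of_le hle, pow_zero]; exact one_dvd _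
    · have h2 := A.mem_derModule.1 hψ i
      rw [hp, Derivation.smul_apply, smul_eq_mul, hg, mul_left_comm,
        show ν i = μ i + (ν i - μ i) by omega, pow_add] at h2
      exact (A.form_prime i).pow_dvd_of_dvd_mul_right _ hgi
        ((mul_dvd_mul_iff_left (pow_ne_zero _ (A.form_ne_zero i))).1 h2)
  obtain ⟨q, rfl⟩ := hdvd
  exact ⟨q, by rw [hp, mul_comm]⟩

theorem formProd_smul_mem {μ ν : ι → ℕ} {θ : PlaneDer K} (hθ : θ ∈ A.derModule μ) :
    (A.formProd fun i => ν i - μ i) • θ ∈ A.derModule ν := by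
  refine A.mem_derModule.2 fun i => ?_
  rw [Derivation.smul_apply, smul_eq_mul]
  refine (pow_dvd_pow _ (show ν i ≤ (ν i - μ i) + μ i by omega)).trans ?_
  rw [pow_add]
  exact mul_dvd_mul (Finset.dvd_prod_of_mem _ (Finset.mem_univ i)) (A.mem_derModule.1 hθ i)

theorem isHomogeneousDer_formProd_smul (μ : ι → ℕ) {θ : PlaneDer K} {d : ℕ}
    (hd : IsHomogeneousDer θ d) : IsHomogeneousDer (A.formProd μ • θ) ((∑ i, μ i) + d) :=
  fun j => (A.formProd_isHomogeneous μ).mul (hd j)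

/-- `A` has a derivation of degree `d` which is saturated and has orders exactly `μ`. -/
structure IsCentral (A : PlaneArrangement K ι) (μ : ι → ℕ) (θ : PlaneDer K) (d : ℕ) : Prop where
  mem : θ ∈ A.derModule μ
  homogeneous : IsHomogeneousDer θ d
  isRelPrime : IsRelPrime (θ (X 0)) (θ (X 1))
  not_dvd : ∀ i, ¬ A.form i ^ (μ i + 1) ∣ θ (A.form i)

/-- Below the degree threshold, the basis element of degree `e₁` is a constant multiple of the
central derivation times the missing forms, which determines `e₁`. Above it, `2 * e₁ ≥ |ν| + δ -
dist(μ, ν) ≥ |ν|`; with `e₁ ≤ e₂` this forces `e₁ = e₂` and distance `δ`. -/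
theorem IsCentral.sub_exponents_of_le {μ ν : ι → ℕ} {θ : PlaneDer K} {d δ e₁ e₂ : ℕ}
    (h : A.IsCentral μ θ d) (hsum : ∑ i, μ i = 2 * d + δ) (hν : multDist μ ν ≤ δ)
    (hle : e₁ ≤ e₂) (he : A.HasExponents ν e₁ e₂) : e₂ - e₁ + multDist μ ν = δ := by
  obtain ⟨b, h1, h2⟩ := he
  have hs := degree_add_eq b h1 h2
  set a : ι → ℕ := fun i => ν i - μ i with ha
  have e1 : multDist μ ν + 2 * ∑ i, min (μ i) (ν i) = ∑ i, μ i + ∑ i, ν i := by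
    rw [multDist, Finset.mul_sum, ← Finset.sum_add_distrib, ← Finset.sum_add_distrib]
    exact Finset.sum_congr rfl fun i _ => by omega
  have e2 : ∑ i, a i + ∑ i, min (μ i) (ν i) = ∑ i, ν i := by
    rw [← Finset.sum_add_distrib]
    exact Finset.sum_congr rfl fun i _ => by simp only [ha]; omega
  have hb0 : (b 0).1 ≠ 0 := fun h0 => b.ne_zero 0 (Subtype.ext h0)
  by_cases hlt : e₁ + d < ∑ i, min (μ i) (ν i)
  · obtain ⟨p, hp⟩ := eq_smul_of_degree_lt h.mem h.homogeneous h.isRelPrime h.not_dvd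
      (b 0).2 h1 hlt
    have hφ := formProd_smul_mem (ν := ν) h.mem
    have hφd := isHomogeneousDer_formProd_smul (A := A) a h.homogeneous
    set φ := A.formProd a • θ with hφdef
    have hp' : b 0 = p • (⟨φ, hφ⟩ : A.derModule ν) := by
      apply Subtype.ext
      rw [hp, mul_smul]; rfl
    -- A basis element is divisible only by units: its own coordinate `1` is a multiple of `p`.
    have hr := congrArg (fun x => b.repr x 0) hp'
    simp only [Module.Basis.repr_self, map_smul, Finsupp.single_eq_same, Finsupp.smul_apply,
      smul_eq_mul] at hr
    obtain ⟨c, hc, hcp⟩ := isUnit_iff_eq_C_of_isReduced.1 (IsUnit.of_mul_eq_one _ hr.symm)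
    have hdeg : e₁ = ∑ i, a i + d := by
      obtain ⟨j, hj⟩ : ∃ j, (b 0).1 (X j) ≠ 0 := by
        by_contra! hall
        exact hb0 (planeDer_ext (hall 0) (hall 1))
      refine (h1 j).inj_right ?_ hj
      have h3 : (b 0).1 = (C c : MvPolynomial (Fin 2) K) • φ := by
        rw [← hcp]; exact congrArg Subtype.val hp'
      rw [h3]
      exact (hφd j).C_mul c
    omega
  · omega

theorem IsCentral.sub_exponents {μ ν : ι → ℕ} {θ : PlaneDer K} {d δ e₁ e₂ : ℕ}
    (h : A.IsCentral μ θ d) (hsum : ∑ i, μ i = 2 * d + δ) (hν : multDist μ ν ≤ δ)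
    (he : A.HasExponents ν e₁ e₂) : ((e₁ : ℤ) - e₂).natAbs + multDist μ ν = δ := by
  rcases le_total e₁ e₂ with hle | hle
  · have := h.sub_exponents_of_le hsum hν hle he
    omega
  · have := h.sub_exponents_of_le hsum hν hle he.symm
    omega

theorem IsCentral.delta_add_multDist {μ ν : ι → ℕ} {θ : PlaneDer K} {d δ : ℕ}
    (h : A.IsCentral μ θ d) (hsum : ∑ i, μ i = 2 * d + δ) (hν : multDist μ ν ≤ δ) :
    A.Delta ν + multDist μ ν = δ := by
  have hset : {n | ∃ d₁ d₂ : ℕ, A.HasExponents ν d₁ d₂ ∧ n = ((d₁ : ℤ) - d₂).natAbs}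
      = {δ - multDist μ ν} := by
    ext n
    simp only [Set.mem_ofPred_eq, Set.mem_singleton_iff]
    constructor
    · rintro ⟨d₁, d₂, he, rfl⟩
      have := h.sub_exponents hsum hν he
      omega
    · rintro rfl
      obtain ⟨d₁, d₂, he⟩ := A.exists_hasExponents ν
      have := h.sub_exponents hsum hν he
      exact ⟨d₁, d₂, he, by omega⟩
  rw [Delta, hset, csInf_singleton]
  omega

end PlaneArrangement

/-! ### Distance and balls in the multiplicity lattice. -/

section Lattice

variable {ι : Type*} [Fintype ι]

theorem multDist_self (μ : ι → ℕ) : multDist μ μ = 0 := by simp [multDist]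

theorem multDist_eq_zero {μ ν : ι → ℕ} (h : multDist μ ν = 0) : ν = μ := by
  funext i
  have := Finset.sum_eq_zero_iff.1 h i (Finset.mem_univ i)
  omega

theorem multBall_finite (μ : ι → ℕ) (r : ℕ) : (multBall μ r).Finite := by
  classical
  refine (Set.finite_Icc (0 : ι → ℕ) (fun i => μ i + r)).subset
    fun ν hν => ⟨fun i => Nat.zero_le _, ?_⟩
  intro i
  have h1 : ((μ i : ℤ) - ν i).natAbs ≤ multDist μ ν :=
    Finset.single_le_sum (f := fun i => ((μ i : ℤ) - ν i).natAbs) (fun _ _ => Nat.zero_le _)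
      (Finset.mem_univ i)
  have h2 : multDist μ ν < r := hν
  show ν i ≤ μ i + r
  omega

theorem multDist_update [DecidableEq ι] (μ ν : ι → ℕ) (i : ι) (x : ℕ) :
    multDist μ (Function.update ν i x) + ((μ i : ℤ) - ν i).natAbs
      = multDist μ ν + ((μ i : ℤ) - x).natAbs := by
  rw [multDist, multDist, ← Finset.add_sum_erase _ _ (Finset.mem_univ i),
    ← Finset.add_sum_erase Finset.univ (fun i => ((μ i : ℤ) - ν i).natAbs) (Finset.mem_univ i),
    Function.update_self, Finset.sum_congr rfl fun j hj => by
      rw [Function.update_of_ne (Finset.ne_of_mem_erase hj)]]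
  ring

theorem multDist_le_of_covBy {μ ν ν' : ι → ℕ} (h : ν ⋖ ν') :
    multDist μ ν' ≤ multDist μ ν + 1 ∧ multDist μ ν ≤ multDist μ ν' + 1 := by
  classical
  obtain ⟨i, x, hx, rfl⟩ := Pi.covBy_iff_exists_right_eq.1 h
  have := multDist_update μ ν i x
  have hx' := Nat.covBy_iff_add_one_eq.1 hx
  omega

theorem multDist_le_of_adj {μ ν ν' : ι → ℕ} (h : (SimpleGraph.hasse (ι → ℕ)).Adj ν ν') :
    multDist μ ν' ≤ multDist μ ν + 1 := by
  rcases SimpleGraph.hasse_adj.1 h with h | h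
  · exact (multDist_le_of_covBy h).1
  · exact (multDist_le_of_covBy h).2

theorem exists_adj_multDist_lt {μ ν : ι → ℕ} (h : multDist μ ν ≠ 0) :
    ∃ ν', (SimpleGraph.hasse (ι → ℕ)).Adj ν ν' ∧ multDist μ ν' + 1 = multDist μ ν := by
  classical
  obtain ⟨i, hi⟩ : ∃ i, μ i ≠ ν i := by
    by_contra! hall
    rw [funext hall] at h
    exact h (multDist_self ν)
  rcases lt_or_gt_of_ne hi with hlt | hlt
  · refine ⟨Function.update ν i (ν i - 1), SimpleGraph.hasse_adj.2 (Or.inr ?_), ?_⟩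
    · exact Pi.covBy_iff_exists_left_eq.2
        ⟨i, ν i - 1, Nat.covBy_iff_add_one_eq.2 (by omega), rfl⟩
    · have := multDist_update μ ν i (ν i - 1)
      omega
  · refine ⟨Function.update ν i (ν i + 1), SimpleGraph.hasse_adj.2 (Or.inl ?_), ?_⟩
    · exact Pi.covBy_iff_exists_right_eq.2
        ⟨i, ν i + 1, Nat.covBy_iff_add_one_eq.2 rfl, rfl⟩
    · have := multDist_update μ ν i (ν i + 1)
      omega

end Lattice

/-! ### The ball as a connected component. -/

namespace PlaneArrangement

variable {K : Type*} [Field K] {ι : Type*} {A : PlaneArrangement K ι} [Fintype ι]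

/-- Inside the ball, one can always step towards the center without leaving the support. A walk
leaving the ball would meet the sphere of radius `δ`, since each step changes the distance by at
most one, and there `Δ = 0`. -/
theorem multBall_mem_components {μ : ι → ℕ} {δ : ℕ} (hδ : 0 < δ)
    (h : ∀ ν, multDist μ ν ≤ δ → A.Delta ν + multDist μ ν = δ) :
    multBall μ δ ∈ A.components := by
  have hsupp : ∀ ν, multDist μ ν < δ → ν ∈ A.support := fun ν hν => by
    have := h ν hν.le
    show 0 < A.Delta ν
    omega
  have hμ : μ ∈ A.support := hsupp μ (by rwa [multDist_self])
  set G := (SimpleGraph.hasse (ι → ℕ)).induce A.support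
  have hin : ∀ ν (hν : ν ∈ A.support), multDist μ ν < δ → G.Reachable ⟨ν, hν⟩ ⟨μ, hμ⟩ := by
    intro ν
    induction hn : multDist μ ν generalizing ν with
    | zero =>
      intro hν _
      obtain rfl := multDist_eq_zero hn
      exact SimpleGraph.Reachable.refl _
    | succ n ih =>
      intro hν hlt
      obtain ⟨ν', hadj, hd⟩ := exists_adj_multDist_lt (μ := μ) (ν := ν) (by omega)
      have hν' := hsupp ν' (by omega)
      have hG : G.Adj ⟨ν, hν⟩ ⟨ν', hν'⟩ := hadj
      exact hG.reachable.trans (ih ν' (by omega) hν' (by omega))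
  have hout : ∀ x y : A.support, G.Walk x y → multDist μ x.1 < δ → multDist μ y.1 < δ := by
    intro x y w
    induction w with
    | nil => exact id
    | @cons x z y hadj _ ih =>
      intro hx
      refine ih ?_
      have h1 : multDist μ z.1 ≤ multDist μ x.1 + 1 :=
        multDist_le_of_adj (SimpleGraph.comap_adj.1 hadj)
      have h2 := h z.1 (by omega)
      have h3 : 0 < A.Delta z.1 := z.2
      omega
  refine ⟨G.connectedComponentMk ⟨μ, hμ⟩, ?_⟩
  ext ν
  constructor
  · intro hν
    exact ⟨⟨ν, hsupp ν hν⟩, SimpleGraph.ConnectedComponent.eq.2 (hin ν _ hν), rfl⟩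
  · rintro ⟨x, hx, rfl⟩
    obtain ⟨w⟩ := (SimpleGraph.ConnectedComponent.eq.1 hx).symm
    exact hout _ _ w (by rwa [multDist_self])

/-- A central derivation of degree less than half of the total multiplicity makes `μ` the center
of a ball-shaped component of the support of `Δ`. -/
theorem IsCentral.component {μ : ι → ℕ} {θ : PlaneDer K} {d δ : ℕ}
    (h : A.IsCentral μ θ d) (hδ : 0 < δ) (hsum : ∑ i, μ i = 2 * d + δ) :
    μ ∈ A.allMaxPoints ∧ ∃ C ∈ A.finiteComponents,
      A.maxPoints C = {μ} ∧ C = multBall μ (A.Delta μ) := by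
  have hdelta : ∀ ν, multDist μ ν ≤ δ → A.Delta ν + multDist μ ν = δ := fun ν hν =>
    h.delta_add_multDist hsum hν
  have hμ : A.Delta μ = δ := by
    have := hdelta μ (by rw [multDist_self]; exact Nat.zero_le _)
    rwa [multDist_self] at this
  have hC : multBall μ δ ∈ A.finiteComponents :=
    ⟨multBall_mem_components hδ hdelta, multBall_finite _ _⟩
  have hcenter : μ ∈ multBall μ δ := by
    show multDist μ μ < δ
    rwa [multDist_self]
  have hmax : A.maxPoints (multBall μ δ) = {μ} := by
    ext ν
    constructor
    · rintro ⟨h1, h2⟩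
      have h3 := h2 μ hcenter
      have h4 := hdelta ν (le_of_lt h1)
      exact multDist_eq_zero (by omega)
    · rintro rfl
      refine ⟨hcenter, fun ν hν => ?_⟩
      have h4 := hdelta ν (le_of_lt hν)
      omega
  refine ⟨Set.mem_biUnion hC (by rw [hmax]; rfl), _, hC, hmax, by rw [hμ]⟩

end PlaneArrangement

/-! ### Complex coordinates and the hypergeometric polynomial. -/

/-- The ring `S[i]`, where `S = K[x, y]` and `i ^ 2 = -1`. -/
abbrev GaussPoly (K : Type*) [Field K] := QuadraticAlgebra (MvPolynomial (Fin 2) K) (-1) 0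

namespace GaussPoly

/-- The inclusion of `S` in `S[i]`. -/
abbrev ofPoly (K : Type*) [Field K] : MvPolynomial (Fin 2) K →+* GaussPoly K := algebraMap _ _

variable (K : Type*) [Field K]

/-- The infinitesimal rotation `x ∂_y - y ∂_x`. -/
def rot : PlaneDer K :=
  (X 0 : MvPolynomial (Fin 2) K) • pderiv 1 - (X 1 : MvPolynomial (Fin 2) K) • pderiv 0

variable {K}

theorem rot_apply (p : MvPolynomial (Fin 2) K) :
    rot K p = X 0 * pderiv 1 p - X 1 * pderiv 0 p := rfl

theorem rot_X_zero : rot K (X 0) = -X 1 := by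
  rw [rot_apply]; simp [pderiv_X]

theorem rot_X_one : rot K (X 1) = X 0 := by
  rw [rot_apply]; simp [pderiv_X]

variable (K)

/-- The infinitesimal rotation, acting on both components of an element of `S[i]`. -/
def rotG : Derivation K (GaussPoly K) (GaussPoly K) :=
  Derivation.mk'
    { toFun := fun z => ⟨rot K z.re, rot K z.im⟩
      map_add' := fun z w => by ext1 <;> simp
      map_smul' := fun c z => by ext1 <;> simp }
    (fun z w => by
      ext1 <;>
      · simp only [LinearMap.coe_mk, AddHom.coe_mk, QuadraticAlgebra.re_mul,
          QuadraticAlgebra.im_mul, QuadraticAlgebra.re_add, QuadraticAlgebra.im_add, smul_eq_mul,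
          map_add, Derivation.leibniz, map_neg, zero_mul, neg_mul, one_mul, add_zero]
        ring)

variable {K}

theorem rotG_re (z : GaussPoly K) : (rotG K z).re = rot K z.re := rfl

theorem rotG_im (z : GaussPoly K) : (rotG K z).im = rot K z.im := rfl

variable (K)

/-- The imaginary unit. -/
def I : GaussPoly K := ⟨0, 1⟩

/-- The complex coordinate `x + i y`. -/
def z : GaussPoly K := ⟨X 0, X 1⟩

/-- The conjugate complex coordinate `x - i y`. -/
def w : GaussPoly K := ⟨X 0, -X 1⟩

/-- The quadratic invariant `x ^ 2 + y ^ 2`. -/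
def normSq : MvPolynomial (Fin 2) K := X 0 ^ 2 + X 1 ^ 2

theorem I_mul_I : I K * I K = -1 := by
  ext1 <;> simp [I, QuadraticAlgebra.re_one, QuadraticAlgebra.im_one]

theorem z_mul_w : z K * w K = ofPoly K (normSq K) := by
  ext1
  · rw [QuadraticAlgebra.algebraMap_re, QuadraticAlgebra.re_mul]; simp only [z, w, normSq]; ring
  · simp [z, w]; ring

theorem rotG_z : rotG K (z K) = I K * z K := by
  ext1
  · rw [rotG_re]; simp [z, I, rot_X_zero]
  · rw [rotG_im]; simp [z, I, rot_X_one]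

theorem rotG_w : rotG K (w K) = -(I K * w K) := by
  ext1
  · rw [rotG_re]; simp [w, I, rot_X_zero]
  · rw [rotG_im]; simp [w, I, rot_X_one]

theorem rotG_I : rotG K (I K) = 0 := by
  ext1
  · rw [rotG_re]; simp [I]
  · rw [rotG_im]; simp [I]

theorem rotG_z_pow (n : ℕ) : rotG K (z K ^ n) = n * I K * z K ^ n := by
  induction n with
  | zero => simp
  | succ n ih =>
    rw [pow_succ, Derivation.leibniz, ih, rotG_z, smul_eq_mul, smul_eq_mul]; push_cast; ring

theorem rotG_w_pow (n : ℕ) : rotG K (w K ^ n) = -(n * I K * w K ^ n) := by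
  induction n with
  | zero => simp
  | succ n ih =>
    rw [pow_succ, Derivation.leibniz, ih, rotG_w, smul_eq_mul, smul_eq_mul]; push_cast; ring

theorem w_pow (n : ℕ) : w K ^ n = ⟨(z K ^ n).re, -(z K ^ n).im⟩ := by
  induction n with
  | zero => ext1 <;> simp [QuadraticAlgebra.re_one, QuadraticAlgebra.im_one]
  | succ n ih =>
    rw [pow_succ, pow_succ, ih]
    ext1 <;> simp [z, w]
    ring

/-- The coefficients of the hypergeometric polynomial. -/
def coef (m k : ℕ) : ℕ → ℚ
  | 0 => 1
  | j + 1 => coef m k j * (((k : ℚ) - j) * (m * ((k : ℚ) - j) - 1)) / ((j + 1) * (1 + m * (j + 1)))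

variable {K}

theorem coef_succ (m k j : ℕ) :
    coef m k (j + 1) * ((j + 1) * (1 + m * (j + 1)))
      = coef m k j * (((k : ℚ) - j) * (m * ((k : ℚ) - j) - 1)) := by
  rw [coef, div_mul_cancel₀]
  positivity

/-- For `j < k` and `m ≥ 2` the factor `m * (k - j) - 1` is positive. Positivity keeps both the sum
of the coefficients (the value on the mirrors) and the top coefficient (the value modulo `x ^ 2 + y
^ 2`) from vanishing. -/
theorem coef_pos {m k : ℕ} (hm : 2 ≤ m) {j : ℕ} (hj : j ≤ k) : 0 < coef m k j := by
  induction j with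
  | zero => exact one_pos
  | succ j ih =>
    have h1 : (1 : ℚ) ≤ (k : ℚ) - j := by
      have : ((j + 1 : ℕ) : ℚ) ≤ k := by exact_mod_cast hj
      push_cast at this; linarith
    have h2 : (2 : ℚ) ≤ m := by exact_mod_cast hm
    have h3 : (0 : ℚ) < m * ((k : ℚ) - j) - 1 := by nlinarith
    have := ih (by omega)
    rw [coef]
    positivity

theorem coef_sum_pos {m k : ℕ} (hm : 2 ≤ m) : 0 < ∑ j ∈ Finset.range (k + 1), coef m k j :=
  Finset.sum_pos (fun j hj => coef_pos hm (by simp at hj; omega)) ⟨0, by simp⟩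

theorem coef_eq_zero (m k : ℕ) : coef m k (k + 1) = 0 := by
  rw [coef]; simp

variable (K)

/-- The hypergeometric polynomial, homogenized in `z ^ m` and `w ^ m`. -/
def hyp (m k : ℕ) : GaussPoly K :=
  ∑ j ∈ Finset.range (k + 1),
    algebraMap K (GaussPoly K) (coef m k j) * ((z K ^ m) ^ j * (w K ^ m) ^ (k - j))

theorem rotG_monomial (m j l : ℕ) :
    rotG K (z K * ((z K ^ m) ^ j * (w K ^ m) ^ l))
      = (1 + m * j - m * l) * I K * (z K * ((z K ^ m) ^ j * (w K ^ m) ^ l)) := by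
  simp only [← pow_mul]
  rw [Derivation.leibniz, Derivation.leibniz, rotG_z_pow, rotG_w_pow, rotG_z]
  simp only [smul_eq_mul]
  push_cast; ring

/-- Each monomial `z * Z ^ j * W ^ (k - j)` is an eigenvector of the rotation, with eigenvalue `1 +
m * j - m * (k - j)` times `i`. The recurrence of `coef` is exactly what makes the resulting sum
telescope. -/
theorem hyp_ode [CharZero K] (m k : ℕ) :
    (z K ^ m - w K ^ m) * (rotG K (rotG K (z K * hyp K m k))
        + (1 - m ^ 2 * k ^ 2) * (z K * hyp K m k))
      = 2 * I K * (k * m * (z K ^ m + w K ^ m) * rotG K (z K * hyp K m k)) := by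
  set κ := algebraMap K (GaussPoly K) with hκ
  set Z := z K ^ m with hZ
  set W := w K ^ m with hW
  let M : ℕ → GaussPoly K := fun j => z K * (Z ^ j * W ^ (k - j))
  have hF : z K * hyp K m k = ∑ j ∈ Finset.range (k + 1), κ (coef m k j) * M j := by
    rw [hyp, Finset.mul_sum]
    exact Finset.sum_congr rfl fun j _ => by simp only [M]; ring
  have hD : ∀ c j, j ∈ Finset.range (k + 1) → rotG K (κ c * M j)
      = (1 + m * j - m * (k - j)) * I K * (κ c * M j) := fun c j hj => by
    have hkj : ((k - j : ℕ) : GaussPoly K) = k - j := by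
      rw [Nat.cast_sub (by simp at hj; omega)]
    rw [Derivation.leibniz, Derivation.map_algebraMap, rotG_monomial, hkj]
    simp only [smul_eq_mul, M]; ring
  have hD1 : rotG K (z K * hyp K m k) = ∑ j ∈ Finset.range (k + 1),
      (1 + m * j - m * (k - j)) * I K * (κ (coef m k j) * M j) := by
    rw [hF, map_sum]
    exact Finset.sum_congr rfl fun j hj => hD _ j hj
  have hD2 : rotG K (rotG K (z K * hyp K m k)) = ∑ j ∈ Finset.range (k + 1),
      -(1 + m * j - m * (k - j)) ^ 2 * (κ (coef m k j) * M j) := by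
    rw [hD1, map_sum]
    refine Finset.sum_congr rfl fun j hj => ?_
    have h1 : ((1 : GaussPoly K) + m * j - m * (k - j)) * I K * (κ (coef m k j) * M j)
        = I K * (κ ((1 + m * j - m * (k - j)) * coef m k j) * M j) := by
      rw [map_mul]
      simp only [map_add, map_sub, map_mul, map_natCast, map_one]
      ring
    rw [h1, Derivation.leibniz, hD _ j hj, rotG_I, map_mul]
    simp only [map_add, map_sub, map_mul, map_natCast, map_one, smul_eq_mul]
    linear_combination ((1 : GaussPoly K) + m * j - m * (k - j)) ^ 2
      * (κ (coef m k j) * M j) * I_mul_I K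
  -- The `W`-part of the contribution of the `j`-th monomial, by `(1 + 2 * m * j) ^ 2 - 1 = 4 * m *
  -- j * (1 + m * j)`. Its `Z`-part is `-T (j + 1)`. The ends vanish: `T 0` by the factor `j`, `T (k
  -- + 1)` by `coef_eq_zero`.
  let T : ℕ → GaussPoly K := fun j =>
    4 * m * κ (coef m k j * (j * (1 + m * j))) * (z K * (Z ^ j * W ^ (k + 1 - j)))
  have hT : ∑ j ∈ Finset.range (k + 1), (T j - T (j + 1)) = 0 := by
    rw [Finset.sum_range_sub']
    simp [T, coef_eq_zero]
  rw [← sub_eq_zero, hD2, hD1, hF, Finset.mul_sum (s := Finset.range (k + 1)) (a := 1 - _),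
    ← Finset.sum_add_distrib, Finset.mul_sum, Finset.mul_sum, Finset.mul_sum,
    ← Finset.sum_sub_distrib, ← hT]
  refine Finset.sum_congr rfl fun j hj => ?_
  have hjk : j ≤ k := by simp at hj; omega
  have e1 : z K * (Z ^ j * W ^ (k + 1 - j)) = W * M j := by
    simp only [M]
    rw [show k + 1 - j = k - j + 1 by omega]; ring
  have e2 : z K * (Z ^ (j + 1) * W ^ (k + 1 - (j + 1))) = Z * M j := by
    simp only [M]
    rw [show k + 1 - (j + 1) = k - j by omega]; ring
  have e3 : κ (coef m k (j + 1) * ((j + 1 : ℕ) * (1 + m * (j + 1 : ℕ))))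
      = κ (coef m k j) * ((k - j) * (m * (k - j) - 1)) := by
    have := congrArg (fun q : ℚ => κ (q : K)) (coef_succ m k j)
    push_cast at this ⊢
    rw [this]
    simp only [map_sub, map_mul, map_natCast, map_one]
  simp only [T]
  rw [e1, e2, e3]
  simp only [map_add, map_mul, map_natCast, map_one]
  linear_combination (-2 * k * m * (Z + W) * (1 + m * j - m * (k - j)) * κ (coef m k j) * M j)
    * I_mul_I K

end GaussPoly

/-! ### Real and imaginary parts, congruences, and the real equation. -/

namespace GaussPoly

variable (K : Type*) [Field K]

/-- The real part of `(x + i y) ^ m`. -/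
def rePow (m : ℕ) : MvPolynomial (Fin 2) K := (z K ^ m).re

/-- The imaginary part of `(x + i y) ^ m`. -/
def imPow (m : ℕ) : MvPolynomial (Fin 2) K := (z K ^ m).im

theorem rot_imPow (m : ℕ) : rot K (imPow K m) = C (m : K) * rePow K m := by
  have h := congrArg QuadraticAlgebra.im (rotG_z_pow K m)
  rw [rotG_im] at h
  rw [imPow, h, rePow]
  simp [I]

theorem rePow_sq_add_imPow_sq (m : ℕ) : rePow K m ^ 2 + imPow K m ^ 2 = normSq K ^ m := by
  have h := congrArg (fun t => (t ^ m).re) (z_mul_w K)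
  simp only [mul_pow, w_pow] at h
  rw [← map_pow, QuadraticAlgebra.algebraMap_re] at h
  rw [← h, QuadraticAlgebra.re_mul, rePow, imPow]
  ring

/-- Both components of an element of `S[i]` are homogeneous of degree `d`. -/
def IsHomogeneousG (t : GaussPoly K) (d : ℕ) : Prop := t.re.IsHomogeneous d ∧ t.im.IsHomogeneous d

variable {K}

theorem IsHomogeneousG.mul {s t : GaussPoly K} {d e : ℕ} (hs : IsHomogeneousG K s d)
    (ht : IsHomogeneousG K t e) : IsHomogeneousG K (s * t) (d + e) := by
  constructor
  · have e : (s * t).re = s.re * t.re - s.im * t.im := by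
      rw [QuadraticAlgebra.re_mul]; ring
    rw [e]
    exact (hs.1.mul ht.1).sub (hs.2.mul ht.2)
  · have e : (s * t).im = s.re * t.im + s.im * t.re := by
      rw [QuadraticAlgebra.im_mul]; ring
    rw [e]
    exact (hs.1.mul ht.2).add (hs.2.mul ht.1)

theorem isHomogeneousG_one : IsHomogeneousG K 1 0 :=
  ⟨isHomogeneous_one _ _, isHomogeneous_zero _ _ _⟩

theorem IsHomogeneousG.pow {t : GaussPoly K} {d : ℕ} (ht : IsHomogeneousG K t d) (n : ℕ) :
    IsHomogeneousG K (t ^ n) (d * n) := by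
  induction n with
  | zero => simpa using isHomogeneousG_one
  | succ n ih => rw [pow_succ, Nat.mul_succ]; exact ih.mul ht

theorem isHomogeneousG_z : IsHomogeneousG K (z K) 1 := ⟨isHomogeneous_X _ _, isHomogeneous_X _ _⟩

theorem isHomogeneousG_w : IsHomogeneousG K (w K) 1 :=
  ⟨isHomogeneous_X _ _, (isHomogeneous_X _ _).neg⟩

theorem isHomogeneousG_algebraMap (c : K) : IsHomogeneousG K (algebraMap K (GaussPoly K) c) 0 :=
  ⟨isHomogeneous_C _ _, isHomogeneous_zero _ _ _⟩

theorem isHomogeneousG_sum {s : Finset ℕ} {f : ℕ → GaussPoly K} {d : ℕ}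
    (h : ∀ j ∈ s, IsHomogeneousG K (f j) d) : IsHomogeneousG K (∑ j ∈ s, f j) d := by
  classical
  induction s using Finset.induction_on with
  | empty => exact ⟨isHomogeneous_zero _ _ _, isHomogeneous_zero _ _ _⟩
  | insert a s ha ih =>
    rw [Finset.sum_insert ha]
    have h1 := h a (Finset.mem_insert_self a s)
    have h2 := ih fun j hj => h j (Finset.mem_insert_of_mem hj)
    exact ⟨h1.1.add h2.1, h1.2.add h2.2⟩

theorem isHomogeneousG_hyp (m k : ℕ) : IsHomogeneousG K (hyp K m k) (m * k) := by
  refine isHomogeneousG_sum fun j hj => ?_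
  have h := (isHomogeneousG_algebraMap (coef m k j : K)).mul
    (((isHomogeneousG_z.pow m).pow j).mul ((isHomogeneousG_w.pow m).pow (k - j)))
  have hjk : j + (k - j) = k := by simp at hj; omega
  rwa [zero_add, one_mul, ← mul_add, hjk] at h

variable (K)

/-- The sum of the coefficients of the hypergeometric polynomial. -/
def coefSum (m k : ℕ) : K := ((∑ j ∈ Finset.range (k + 1), coef m k j : ℚ) : K)

theorem coefSum_ne_zero [CharZero K] {m : ℕ} (hm : 2 ≤ m) (k : ℕ) : coefSum K m k ≠ 0 := by
  rw [coefSum, Rat.cast_ne_zero]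
  exact (coef_sum_pos hm).ne'

/-- Modulo the imaginary part of `z ^ m`, both `z ^ m` and `w ^ m` reduce to the real part, so only
the sum of the coefficients survives. -/
theorem imPow_dvd_hyp_sub [CharZero K] (m k : ℕ) :
    ofPoly K (imPow K m) ∣
      hyp K m k - ofPoly K (C (coefSum K m k) * rePow K m ^ k) := by
  set φ := ofPoly K with hφ
  have hZ : φ (imPow K m) ∣ z K ^ m - φ (rePow K m) :=
    ⟨I K, by ext1 <;> simp [hφ, imPow, rePow, I]⟩
  have hW : φ (imPow K m) ∣ w K ^ m - φ (rePow K m) :=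
    ⟨-I K, by rw [w_pow]; ext1 <;> simp [hφ, imPow, rePow, I]⟩
  have hC : φ (C (coefSum K m k)) = ∑ j ∈ Finset.range (k + 1),
      algebraMap K (GaussPoly K) (coef m k j) := by
    rw [coefSum, Rat.cast_sum, map_sum, map_sum]; rfl
  rw [map_mul, hC, hyp, Finset.sum_mul, ← Finset.sum_sub_distrib]
  refine Finset.dvd_sum fun j hj => ?_
  have hjk : j + (k - j) = k := by simp at hj; omega
  rw [← mul_sub]
  refine Dvd.dvd.mul_left ?_ _
  have h1 := hZ.trans (sub_dvd_pow_sub_pow (z K ^ m) (φ (rePow K m)) j)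
  have h2 := hW.trans (sub_dvd_pow_sub_pow (w K ^ m) (φ (rePow K m)) (k - j))
  have h3 := (h1.mul_right ((w K ^ m) ^ (k - j))).add (h2.mul_left (φ (rePow K m) ^ j))
  convert h3 using 1
  conv_lhs => rw [map_pow, ← hjk, pow_add, add_tsub_cancel_left]
  ring

theorem imPow_dvd_hyp_re [CharZero K] (m k : ℕ) :
    imPow K m ∣ (hyp K m k).re - C (coefSum K m k) * rePow K m ^ k := by
  have := (QuadraticAlgebra.algebraMap_dvd_iff.1 (imPow_dvd_hyp_sub K m k)).1
  rwa [QuadraticAlgebra.re_sub, QuadraticAlgebra.algebraMap_re] at this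

theorem imPow_dvd_hyp_im [CharZero K] (m k : ℕ) : imPow K m ∣ (hyp K m k).im := by
  have := (QuadraticAlgebra.algebraMap_dvd_iff.1 (imPow_dvd_hyp_sub K m k)).2
  rwa [QuadraticAlgebra.im_sub, QuadraticAlgebra.algebraMap_im, sub_zero] at this

theorem normSq_dvd_z_pow_sub (n : ℕ) :
    ofPoly K (normSq K) ∣
      z K ^ (n + 1) - ofPoly K ((2 * X 0) ^ n) * z K := by
  set φ := ofPoly K with hφ
  induction n with
  | zero => simp
  | succ n ih =>
    have hzw : φ (2 * X 0) = z K + w K := by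
      ext1
      · rw [QuadraticAlgebra.algebraMap_re, QuadraticAlgebra.re_add]; simp only [z, w]; ring
      · rw [QuadraticAlgebra.algebraMap_im, QuadraticAlgebra.im_add]; simp only [z, w]; ring
    have h1 := (ih.mul_left (φ (2 * X 0))).sub (Dvd.intro (z K ^ n) rfl)
    convert h1 using 1
    rw [← z_mul_w, map_pow, map_pow, hzw]
    ring

/-- As `x ^ 2 + y ^ 2 = z * w`, every term containing `w` dies after multiplication by `z`. Only `j
= k` remains, and `z ^ 2` reduces to `2 * x * z`. -/
theorem normSq_dvd_hyp_sub {m : ℕ} (hm : m ≠ 0) (k : ℕ) :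
    ofPoly K (normSq K) ∣
      z K * hyp K m k
        - ofPoly K (C (coef m k k : K) * (2 * X 0) ^ (m * k)) * z K := by
  set φ := ofPoly K with hφ
  have h1 := (normSq_dvd_z_pow_sub K (m * k)).mul_left (φ (C (coef m k k : K)))
  have h2 : φ (normSq K) ∣ ∑ j ∈ Finset.range k, z K *
      (algebraMap K (GaussPoly K) (coef m k j) * ((z K ^ m) ^ j * (w K ^ m) ^ (k - j))) := by
    refine Finset.dvd_sum fun j hj => ?_
    have hjk : k - j ≠ 0 := by simp at hj; omega
    have hw : w K ∣ (w K ^ m) ^ (k - j) := (dvd_pow_self _ hm).trans (dvd_pow_self _ hjk)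
    rw [← z_mul_w]
    exact mul_dvd_mul_left _ ((hw.mul_left _).mul_left _)
  have h3 := h2.add h1
  convert h3 using 1
  rw [hyp, Finset.sum_range_succ, mul_add, Finset.mul_sum, map_mul, Nat.sub_self]
  have : algebraMap K (GaussPoly K) (coef m k k) = φ (C (coef m k k : K)) := rfl
  rw [this]
  ring

/-- A solution of the equation of the hypergeometric polynomial, restricted to circles. -/
def IsSolution (m k : ℕ) (h : MvPolynomial (Fin 2) K) : Prop :=
  imPow K m * (rot K (rot K h) + C (1 - (m : K) ^ 2 * (k : K) ^ 2) * h)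
    = C (2 * (k : K) * m) * rePow K m * rot K h

variable {K}

/-- After division by `2 * i` the complex equation has coefficients in `S`, so it splits into its
components. -/
theorem isSolution_hyp [CharZero K] (m k : ℕ) :
    IsSolution K m k (z K * hyp K m k).re ∧ IsSolution K m k (z K * hyp K m k).im := by
  have h := hyp_ode K m k
  set F := z K * hyp K m k with hF
  set κ := algebraMap K (GaussPoly K)
  have e1 : z K ^ m - w K ^ m = 2 * I K * ofPoly K (imPow K m) := by
    rw [w_pow]
    ext1
    · simp [I, imPow, QuadraticAlgebra.im_ofNat]
    · simp [I, imPow, QuadraticAlgebra.re_ofNat]; ring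
  have e2 : z K ^ m + w K ^ m = 2 * ofPoly K (rePow K m) := by
    rw [w_pow]
    ext1
    · simp [rePow, QuadraticAlgebra.re_ofNat]; ring
    · simp [rePow, QuadraticAlgebra.im_ofNat]
  have e3 : ofPoly K (C (1 - (m : K) ^ 2 * (k : K) ^ 2)) = 1 - m ^ 2 * k ^ 2 := by
    have : ofPoly K (C (1 - (m : K) ^ 2 * (k : K) ^ 2)) = κ (1 - (m : K) ^ 2 * (k : K) ^ 2) := rfl
    rw [this]; simp only [map_sub, map_mul, map_pow, map_natCast, map_one]
  have e4 : ofPoly K (C (2 * (k : K) * m)) = 2 * k * m := by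
    have : ofPoly K (C (2 * (k : K) * m)) = κ (2 * (k : K) * m) := rfl
    rw [this]; simp only [map_mul, map_natCast, map_ofNat]
  have hκ : 2 * κ (-1 / 2) = -1 := by
    rw [← map_ofNat κ 2, ← map_mul, show (2 : K) * (-1 / 2) = -1 by ring, map_neg, map_one]
  have hI : 2 * I K * (I K * κ (-1 / 2)) = 1 := by
    linear_combination (2 * κ (-1 / 2)) * I_mul_I K - hκ
  have h' : ofPoly K (imPow K m) * (rotG K (rotG K F)
      + ofPoly K (C (1 - (m : K) ^ 2 * (k : K) ^ 2)) * F)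
      = ofPoly K (C (2 * (k : K) * m)) * ofPoly K (rePow K m) * rotG K F := by
    rw [e1, e2] at h
    rw [e3, e4]
    linear_combination (I K * κ (-1 / 2)) * h + (-ofPoly K (imPow K m) * (rotG K (rotG K F)
      + (1 - m ^ 2 * k ^ 2) * F)
      + 2 * k * m * ofPoly K (rePow K m) * rotG K F) * hI
  constructor
  · have := congrArg QuadraticAlgebra.re h'
    rw [← map_mul, ofPoly, ← QuadraticAlgebra.C_eq_algebraMap, QuadraticAlgebra.C_mul_eq_smul,
      QuadraticAlgebra.C_mul_eq_smul, QuadraticAlgebra.C_mul_eq_smul] at this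
    exact this
  · have := congrArg QuadraticAlgebra.im h'
    rw [← map_mul, ofPoly, ← QuadraticAlgebra.C_eq_algebraMap, QuadraticAlgebra.C_mul_eq_smul,
      QuadraticAlgebra.C_mul_eq_smul, QuadraticAlgebra.C_mul_eq_smul] at this
    exact this

end GaussPoly

/-! ### Orders along primes under derivations. -/

section Derivation

variable {K : Type*} [Field K]

/-- Along a prime `p` which does not divide `D p`, the order of a polynomial drops under `D`. -/
theorem dvd_mul_derivation_of_pow_dvd [CharZero K] (D : PlaneDer K)
    {p u b : MvPolynomial (Fin 2) K} {e : ℕ} (hp : Prime p) (hu : ¬ p ∣ u)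
    (h : p ^ (e + 1) ∣ b * D (p ^ (e + 1) * u)) : p ∣ b * D p := by
  have h1 : b * D (p ^ (e + 1) * u)
      = p ^ e * (C ((e : K) + 1) * (b * D p * u) + p * (b * D u)) := by
    rw [Derivation.leibniz, Derivation.leibniz_pow]
    simp only [smul_eq_mul, nsmul_eq_mul, Nat.add_sub_cancel, map_add, C_1, map_natCast]
    push_cast; ring
  rw [h1, pow_succ, mul_dvd_mul_iff_left (pow_ne_zero _ hp.ne_zero),
    dvd_add_left (Dvd.intro _ rfl)] at h
  have he : IsUnit (C ((e : K) + 1) : MvPolynomial (Fin 2) K) :=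
    (isUnit_iff_ne_zero.2 (by exact_mod_cast Nat.succ_ne_zero e)).map C
  exact (hp.dvd_or_dvd (he.dvd_mul_left.1 h)).resolve_right hu

theorem pderiv_eq_zero_of_dvd {p : MvPolynomial (Fin 2) K} {i : Fin 2} (h : p ∣ pderiv i p) :
    pderiv i p = 0 := by
  by_contra h0
  have hp0 : p ≠ 0 := by rintro rfl; simp at h0
  have h1 : p.totalDegree ≤ (pderiv i p).totalDegree := by
    obtain ⟨q, hq⟩ := h
    have hq0 : q ≠ 0 := by rintro rfl; exact h0 (by rw [hq, mul_zero])
    rw [hq, totalDegree_mul_of_isDomain hp0 hq0]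
    exact Nat.le_add_right _ _
  obtain ⟨s, hs, hdeg⟩ := Finset.exists_mem_eq_sup (pderiv i p).support
    (support_nonempty.2 h0) fun s => s.sum fun _ e => e
  have hs' : s + Finsupp.single i 1 ∈ p.support := by
    rw [mem_support_iff, coeff_pderiv] at hs
    rw [mem_support_iff]
    exact left_ne_zero_of_mul hs
  have h2 := le_totalDegree hs'
  rw [Finsupp.sum_add_index' (fun _ => rfl) (fun _ _ _ => rfl), Finsupp.sum_single_index rfl] at h2
  have h3 : (pderiv i p).totalDegree = s.sum fun _ e => e := hdeg
  omega

theorem eq_C_of_pderiv_eq_zero [CharZero K] {p : MvPolynomial (Fin 2) K}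
    (h : ∀ i, pderiv i p = 0) : p = C (coeff 0 p) := by
  ext s
  rw [coeff_C]
  split_ifs with hs
  · rw [hs]
  · obtain ⟨i, hi⟩ : ∃ i, s i ≠ 0 := by
      by_contra! hall
      exact hs (Finsupp.ext hall).symm
    have h1 := congrArg (coeff (s - Finsupp.single i 1)) (h i)
    rw [coeff_pderiv, coeff_zero, tsub_add_cancel_of_le
      (Finsupp.single_le_iff.2 (Nat.one_le_iff_ne_zero.2 hi))] at h1
    refine (mul_eq_zero.1 h1).resolve_right ?_
    exact Nat.cast_add_one_ne_zero _

end Derivation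

/-! ### Local exponents and the Wronskian of the equation. -/

namespace GaussPoly

variable {K : Type*} [Field K]

theorem normSq_mul_C {a b : K} :
    C a * normSq K = X 0 * (C a * X 0 + C b * X 1) - X 1 * rot K (C a * X 0 + C b * X 1) ∧
    C b * normSq K = X 1 * (C a * X 0 + C b * X 1) + X 0 * rot K (C a * X 0 + C b * X 1) := by
  rw [planeDer_linear, rot_X_zero, rot_X_one, normSq]
  constructor <;> ring

theorem not_dvd_rot {α : MvPolynomial (Fin 2) K} (h1 : α.IsHomogeneous 1) (h0 : α ≠ 0)
    (hN : ¬ α ∣ normSq K) : ¬ α ∣ rot K α := by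
  obtain ⟨a, b, rfl⟩ := exists_eq_linear_of_isHomogeneous h1
  intro h
  obtain ⟨ha, hb⟩ := normSq_mul_C (a := a) (b := b)
  by_cases ha0 : a = 0
  · have hb0 : b ≠ 0 := by rintro rfl; apply h0; simp [ha0]
    apply hN
    rw [← ((isUnit_iff_ne_zero.2 hb0).map C).dvd_mul_left, hb]
    exact (Dvd.intro_left _ rfl).add (h.mul_left _)
  · apply hN
    rw [← ((isUnit_iff_ne_zero.2 ha0).map C).dvd_mul_left, ha]
    exact (Dvd.intro_left _ rfl).sub (h.mul_left _)

/-- The exponents of the differential equation along a line are `0` and `2 * k + 1`. -/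
theorem IsSolution.order_eq [CharZero K] {m k n : ℕ} {α q u : MvPolynomial (Fin 2) K}
    (hα : Prime α) (hq : imPow K m = α * q) (hαq : ¬ α ∣ q) (hrot : ¬ α ∣ rot K α)
    (hu : ¬ α ∣ u) (h : IsSolution K m k (α ^ (n + 1) * u)) : n = 2 * k := by
  by_contra hn
  set t := C ((n : K) + 1) * (rot K α * u) + α * rot K u with ht
  have h1 : rot K (α ^ (n + 1) * u) = α ^ n * t := by
    rw [ht, Derivation.leibniz, Derivation.leibniz_pow]
    simp only [smul_eq_mul, nsmul_eq_mul, Nat.add_sub_cancel, map_add, C_1, map_natCast]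
    push_cast; ring
  -- The extra factor `α` avoids the exponent `n - 1`, so that `n = 0` needs no separate equation.
  have h2 : α * rot K (α ^ n * t) = α ^ n * (C (n : K) * rot K α * t + α * rot K t) := by
    rw [Derivation.leibniz, Derivation.leibniz_pow]
    simp only [smul_eq_mul, nsmul_eq_mul, map_natCast]
    rcases n with _ | n
    · push_cast; ring
    · rw [Nat.add_sub_cancel]; push_cast; ring
  have h3 := rot_imPow K m
  rw [hq, Derivation.leibniz, smul_eq_mul, smul_eq_mul] at h3
  rw [IsSolution, h1, hq] at h
  have hαt : ¬ α ∣ t := by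
    rw [ht, dvd_add_left (Dvd.intro _ rfl)]
    have he : IsUnit (C ((n : K) + 1) : MvPolynomial (Fin 2) K) :=
      (isUnit_iff_ne_zero.2 (by exact_mod_cast Nat.succ_ne_zero n)).map C
    rw [he.dvd_mul_left]
    intro hd
    exact (hα.dvd_or_dvd hd).elim hrot hu
  -- The indicial equation: modulo `α`, the equation divided by `α ^ n` leaves `n - 2 * k` times
  -- factors prime to `α`.
  have h4 : C ((n : K) - 2 * k) * (q * (rot K α * t)) = α * (C (2 * (k : K)) * rot K q * t
      - q * rot K t - q * C (1 - (m : K) ^ 2 * (k : K) ^ 2) * α * u) := by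
    refine mul_left_cancel₀ (pow_ne_zero n hα.ne_zero) ?_
    simp only [map_sub, map_mul, map_natCast, map_ofNat, map_one, map_pow] at h h2 h3 ⊢
    linear_combination h - q * h2 - 2 * (k : MvPolynomial (Fin 2) K) * α ^ n * t * h3
  have hnk : IsUnit (C ((n : K) - 2 * k) : MvPolynomial (Fin 2) K) := by
    refine (isUnit_iff_ne_zero.2 (sub_ne_zero.2 ?_)).map C
    exact_mod_cast hn
  have h5 : α ∣ q * (rot K α * t) := hnk.dvd_mul_left.1 (Dvd.intro _ h4.symm)
  rcases hα.dvd_or_dvd h5 with h6 | h6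
  · exact hαq h6
  · exact (hα.dvd_or_dvd h6).elim hrot hαt

theorem IsSolution.C_mul_add {m k : ℕ} {f g : MvPolynomial (Fin 2) K} (hf : IsSolution K m k f)
    (hg : IsSolution K m k g) (a b : K) : IsSolution K m k (C a * f + C b * g) := by
  rw [IsSolution] at hf hg ⊢
  have h : ∀ p q : MvPolynomial (Fin 2) K,
      rot K (C a * p + C b * q) = C a * rot K p + C b * rot K q := by
    intro p q
    simp only [map_add, Derivation.leibniz, derivation_C, smul_eq_mul, mul_zero, add_zero]
  rw [h, h]
  linear_combination C a * hf + C b * hg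

/-- The Wronskian of two solutions is determined by the equation. -/
theorem IsSolution.wronskian {m k : ℕ} {f g : MvPolynomial (Fin 2) K} (hf : IsSolution K m k f)
    (hg : IsSolution K m k g) :
    imPow K m * rot K (f * rot K g - g * rot K f)
      = C (2 * (k : K) * m) * rePow K m * (f * rot K g - g * rot K f) := by
  rw [IsSolution] at hf hg
  simp only [map_sub, Derivation.leibniz, smul_eq_mul]
  linear_combination f * hg - g * hf

end GaussPoly

/-! ### The dihedral derivation. -/

namespace GaussPoly

variable (K : Type*) [Field K]

/-- The invariant derivation of degree `m * k + 1` for the dihedral group of order `2 * m`. -/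
def dihedralDer (m k : ℕ) : PlaneDer K :=
  mkDerivation K ![(z K * hyp K m k).re, (z K * hyp K m k).im]

theorem dihedralDer_X_zero (m k : ℕ) : dihedralDer K m k (X 0) = (z K * hyp K m k).re := by
  rw [dihedralDer, mkDerivation_X]; rfl

theorem dihedralDer_X_one (m k : ℕ) : dihedralDer K m k (X 1) = (z K * hyp K m k).im := by
  rw [dihedralDer, mkDerivation_X]; rfl

/-- Multiplying `z` by `hyp` expresses the derivation as the real part of `hyp` times the Euler
derivation plus the imaginary part times the rotation. -/
theorem dihedralDer_linear (m k : ℕ) (a b : K) :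
    dihedralDer K m k (C a * X 0 + C b * X 1) = (hyp K m k).re * (C a * X 0 + C b * X 1)
      + (hyp K m k).im * rot K (C a * X 0 + C b * X 1) := by
  rw [planeDer_linear, planeDer_linear, dihedralDer_X_zero, dihedralDer_X_one, rot_X_zero,
    rot_X_one, QuadraticAlgebra.re_mul, QuadraticAlgebra.im_mul]
  simp only [z]; ring

theorem dihedralDer_isHomogeneous (m k : ℕ) :
    PlaneArrangement.IsHomogeneousDer (dihedralDer K m k) (m * k + 1) := by
  have h := (isHomogeneousG_z (K := K)).mul (isHomogeneousG_hyp m k)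
  rw [add_comm] at h
  intro j
  fin_cases j
  · exact (dihedralDer_X_zero K m k).symm ▸ h.1
  · exact (dihedralDer_X_one K m k).symm ▸ h.2

theorem isSolution_dihedralDer [CharZero K] (m k : ℕ) :
    IsSolution K m k (dihedralDer K m k (X 0)) ∧ IsSolution K m k (dihedralDer K m k (X 1)) := by
  rw [dihedralDer_X_zero, dihedralDer_X_one]
  exact isSolution_hyp m k

theorem dihedralDer_form {ι : Type*} (A : PlaneArrangement K ι) (m k : ℕ) (i : ι) :
    dihedralDer K m k (A.form i)
      = (hyp K m k).re * A.form i + (hyp K m k).im * rot K (A.form i) := by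
  obtain ⟨a, b, hab⟩ := exists_eq_linear_of_isHomogeneous (A.form_homogeneous i)
  rw [hab, dihedralDer_linear]

end GaussPoly

theorem not_dvd_X_zero_and_X_one {K : Type*} [Field K] {p : MvPolynomial (Fin 2) K}
    (hp : Prime p) (h0 : p ∣ X 0) (h1 : p ∣ X 1) : False := by
  have hX : (X 0 : MvPolynomial (Fin 2) K) ∣ X 1 :=
    ((hp.associated_of_dvd (X_prime (i := 0)) h0).symm.dvd).trans h1
  obtain ⟨q, hq⟩ := hX
  have := congrArg (eval ![(0 : K), 1]) hq
  simp at this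

/-! ### Dihedral arrangements: orders along mirrors and coprimality. -/

namespace PlaneArrangement

open GaussPoly

variable {K : Type*} [Field K] {ι : Type*} [Fintype ι]

/-- The lines of `A` are the mirrors of the dihedral group of order `2 * m`: they are the zeros of
the imaginary part of `(x + i y) ^ m`, and `x ^ 2 + y ^ 2` does not vanish on them. -/
structure IsDihedral (A : PlaneArrangement K ι) (m : ℕ) : Prop where
  two_le : 2 ≤ m
  card : Fintype.card ι = m
  imPow_eq : ∃ c : K, c ≠ 0 ∧ imPow K m = C c * ∏ i, A.form i
  not_dvd : ∀ i, ¬ A.form i ∣ normSq K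

namespace IsDihedral

variable {A : PlaneArrangement K ι} {m : ℕ} (hA : A.IsDihedral m)

include hA

theorem exists_cofactor (i : ι) :
    ∃ q, imPow K m = A.form i * q ∧ ¬ A.form i ∣ q := by
  classical
  obtain ⟨c, hc, h⟩ := hA.imPow_eq
  refine ⟨C c * ∏ j ∈ Finset.univ.erase i, A.form j, ?_, fun hd => ?_⟩
  · rw [h, ← Finset.mul_prod_erase _ _ (Finset.mem_univ i)]; ring
  · rw [((isUnit_iff_ne_zero.2 hc).map C).dvd_mul_left, (A.form_prime i).dvd_finsetProd_iff] at hd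
    obtain ⟨j, hj, hd⟩ := hd
    exact A.form_not_dvd (Finset.ne_of_mem_erase hj).symm hd

theorem form_dvd_imPow (i : ι) : A.form i ∣ imPow K m := by
  obtain ⟨q, hq, -⟩ := hA.exists_cofactor i
  exact Dvd.intro _ hq.symm

theorem not_dvd_rot (i : ι) : ¬ A.form i ∣ rot K (A.form i) :=
  GaussPoly.not_dvd_rot (A.form_homogeneous i) (A.form_ne_zero i) (hA.not_dvd i)

variable [CharZero K]

/-- On a mirror this is a nonzero constant times a power of the real part of `z ^ m`, whose square
equals `(x ^ 2 + y ^ 2) ^ m` there. -/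
theorem not_dvd_hyp_re (k : ℕ) (i : ι) : ¬ A.form i ∣ (hyp K m k).re := by
  intro h
  have h1 := (hA.form_dvd_imPow i).trans (imPow_dvd_hyp_re K m k)
  rw [dvd_sub_right h, ((isUnit_iff_ne_zero.2 (coefSum_ne_zero K hA.two_le k)).map C).dvd_mul_left]
    at h1
  have h2 := (A.form_prime i).dvd_of_dvd_pow h1
  have h3 : A.form i ∣ normSq K ^ m := by
    rw [← rePow_sq_add_imPow_sq]
    exact (dvd_pow h2 two_ne_zero).add (dvd_pow (hA.form_dvd_imPow i) two_ne_zero)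
  exact hA.not_dvd i ((A.form_prime i).dvd_of_dvd_pow h3)

theorem dvd_hyp_im (k : ℕ) (i : ι) : A.form i ∣ (hyp K m k).im :=
  (hA.form_dvd_imPow i).trans (imPow_dvd_hyp_im K m k)

/-- Along a mirror the derivation is a nonzero multiple of the Euler derivation. This serves to show
that `θ(α_i)` is not zero, as a positive order along `H_i` itself could not. -/
theorem not_dvd_der_of_ne (k : ℕ) {i j : ι} (hij : j ≠ i) :
    ¬ A.form j ∣ dihedralDer K m k (A.form i) := by
  rw [dihedralDer_form, dvd_add_left ((hA.dvd_hyp_im k j).mul_right _)]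
  intro h
  exact ((A.form_prime j).dvd_or_dvd h).elim (hA.not_dvd_hyp_re k j) (A.form_not_dvd hij)

theorem der_form_ne_zero (k : ℕ) (i : ι) : dihedralDer K m k (A.form i) ≠ 0 := by
  have : Nontrivial ι := Fintype.one_lt_card_iff_nontrivial.1 (by
    have := hA.two_le; have := hA.card; omega)
  obtain ⟨j, hj⟩ := exists_ne i
  intro h
  exact hA.not_dvd_der_of_ne k hj (by rw [h]; exact dvd_zero _)

theorem not_dvd_der_coeffs (k : ℕ) (i : ι) (h0 : A.form i ∣ dihedralDer K m k (X 0))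
    (h1 : A.form i ∣ dihedralDer K m k (X 1)) : False := by
  have hv := hA.dvd_hyp_im k i
  have hu := hA.not_dvd_hyp_re k i
  have e0 : dihedralDer K m k (X 0) = (hyp K m k).re * X 0 - (hyp K m k).im * X 1 := by
    rw [dihedralDer_X_zero, QuadraticAlgebra.re_mul]; simp only [z]; ring
  have e1 : dihedralDer K m k (X 1) = (hyp K m k).re * X 1 + (hyp K m k).im * X 0 := by
    rw [dihedralDer_X_one, QuadraticAlgebra.im_mul]; simp only [z]; ring
  rw [e0, dvd_sub_left (hv.mul_right _)] at h0
  rw [e1, dvd_add_left (hv.mul_right _)] at h1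
  have hp := A.form_prime i
  exact not_dvd_X_zero_and_X_one hp ((hp.dvd_or_dvd h0).resolve_left hu)
    ((hp.dvd_or_dvd h1).resolve_left hu)

/-- The value on a form is a nonzero solution vanishing on its mirror, so its order is the nonzero
exponent `2 * k + 1`. -/
theorem exists_der_form_eq (k : ℕ) (i : ι) : ∃ u, dihedralDer K m k (A.form i)
    = A.form i ^ (2 * k + 1) * u ∧ ¬ A.form i ∣ u := by
  have hsol : IsSolution K m k (dihedralDer K m k (A.form i)) := by
    obtain ⟨a, b, hab⟩ := exists_eq_linear_of_isHomogeneous (A.form_homogeneous i)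
    rw [hab, planeDer_linear]
    exact (isSolution_dihedralDer K m k).1.C_mul_add (isSolution_dihedralDer K m k).2 a b
  obtain ⟨n, u, hu, hn⟩ := WfDvdMonoid.max_power_factor (hA.der_form_ne_zero k i)
    (A.form_prime i).irreducible
  have hdvd : A.form i ∣ dihedralDer K m k (A.form i) := by
    rw [dihedralDer_form]
    exact (Dvd.intro_left _ rfl).add ((hA.dvd_hyp_im k i).mul_right _)
  rcases n with _ | n
  · rw [hn, pow_zero, one_mul] at hdvd
    exact absurd hdvd hu
  · obtain ⟨q, hq, hiq⟩ := hA.exists_cofactor i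
    rw [hn] at hsol
    have := hsol.order_eq (A.form_prime i) hq hiq (hA.not_dvd_rot i) hu
    subst this
    exact ⟨u, hn, hu⟩

/-- If the Wronskian vanished, both coefficients `g` would satisfy `h * rot g = g * rot h` with `h =
θ(α)`. Since `h` has order `2 * k + 1` and `rot h` only `2 * k`, the form `α` would divide both. -/
theorem wronskian_ne_zero (k : ℕ) :
    dihedralDer K m k (X 0) * rot K (dihedralDer K m k (X 1))
      - dihedralDer K m k (X 1) * rot K (dihedralDer K m k (X 0)) ≠ 0 := by
  intro hW
  have : Nonempty ι := Fintype.card_pos_iff.1 (by have := hA.two_le; have := hA.card; omega)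
  let i : ι := Classical.arbitrary ι
  obtain ⟨a, b, hab⟩ := exists_eq_linear_of_isHomogeneous (A.form_homogeneous i)
  obtain ⟨u, hu, hiu⟩ := hA.exists_der_form_eq k i
  set h := dihedralDer K m k (A.form i) with hh
  have hlin : h = C a * dihedralDer K m k (X 0) + C b * dihedralDer K m k (X 1) := by
    rw [hh, hab, planeDer_linear]
  have hrlin : rot K h = C a * rot K (dihedralDer K m k (X 0))
      + C b * rot K (dihedralDer K m k (X 1)) := by
    rw [hlin]
    simp only [map_add, Derivation.leibniz, derivation_C, smul_eq_mul, mul_zero, add_zero]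
  set t := C ((2 * k : ℕ) + 1 : K) * (rot K (A.form i) * u) + A.form i * rot K u with ht
  have hrot : rot K h = A.form i ^ (2 * k) * t := by
    rw [hu, ht, Derivation.leibniz, Derivation.leibniz_pow]
    simp only [smul_eq_mul, nsmul_eq_mul, Nat.add_sub_cancel, map_add, C_1, map_natCast]
    push_cast; ring
  have hp := A.form_prime i
  have hit : ¬ A.form i ∣ t := by
    have hc : IsUnit (C ((2 * k : ℕ) + 1 : K) : MvPolynomial (Fin 2) K) :=
      (isUnit_iff_ne_zero.2 (Nat.cast_add_one_ne_zero _)).map C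
    rw [ht, dvd_add_left (Dvd.intro _ rfl), hc.dvd_mul_left]
    intro hd
    exact (hp.dvd_or_dvd hd).elim (hA.not_dvd_rot i) hiu
  have key : ∀ g, h * rot K g = g * rot K h → A.form i ∣ g := by
    intro g hg
    rw [hrot, hu] at hg
    have : g * t = A.form i * (u * rot K g) :=
      mul_left_cancel₀ (pow_ne_zero (2 * k) hp.ne_zero) (by linear_combination -hg)
    exact (hp.dvd_or_dvd (Dvd.intro _ this.symm)).resolve_right hit
  refine hA.not_dvd_der_coeffs k i (key _ ?_) (key _ ?_)
  · rw [hrlin, hlin]; linear_combination -C b * hW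
  · rw [hrlin, hlin]; linear_combination C a * hW

/-- A common prime factor `p` divides the nonzero Wronskian, whose first order equation forces `p`
to divide `rot p` or to be a mirror. Mirrors and factors of `x ^ 2 + y ^ 2` are excluded by the
congruences for `hyp`. -/
theorem isRelPrime_der (k : ℕ) :
    IsRelPrime (dihedralDer K m k (X 0)) (dihedralDer K m k (X 1)) := by
  set f := dihedralDer K m k (X 0) with hf
  set g := dihedralDer K m k (X 1) with hg
  have hW0 : f * rot K g - g * rot K f ≠ 0 := hA.wronskian_ne_zero k
  have hm0 : m ≠ 0 := by have := hA.two_le; omega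
  refine WfDvdMonoid.isRelPrime_of_no_irreducible_factors ?_ ?_
  · rintro ⟨h1, h2⟩
    apply hW0; rw [h1, h2]; ring
  intro p hirr hpf hpg
  have hp : Prime p := hirr.prime
  by_cases hpN : p ∣ normSq K
  · have hsub := normSq_dvd_hyp_sub K hm0 k
    have hcu : IsUnit (C (coef m k k : K) : MvPolynomial (Fin 2) K) := by
      refine (isUnit_iff_ne_zero.2 ?_).map C
      rw [Rat.cast_ne_zero]
      exact (coef_pos hA.two_le le_rfl).ne'
    have h2u : IsUnit (2 : MvPolynomial (Fin 2) K) := by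
      have := (isUnit_iff_ne_zero.2 (two_ne_zero (α := K))).map (C (σ := Fin 2))
      rwa [map_ofNat] at this
    have hre := (QuadraticAlgebra.algebraMap_dvd_iff.1 hsub).1
    have him := (QuadraticAlgebra.algebraMap_dvd_iff.1 hsub).2
    rw [QuadraticAlgebra.re_sub, ← dihedralDer_X_zero, ofPoly, ← QuadraticAlgebra.C_eq_algebraMap,
      QuadraticAlgebra.C_mul_eq_smul, QuadraticAlgebra.re_smul, smul_eq_mul] at hre
    rw [QuadraticAlgebra.im_sub, ← dihedralDer_X_one, ofPoly, ← QuadraticAlgebra.C_eq_algebraMap,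
      QuadraticAlgebra.C_mul_eq_smul, QuadraticAlgebra.im_smul, smul_eq_mul] at him
    have h0 := (dvd_sub_right hpf).1 (hpN.trans hre)
    have h1 := (dvd_sub_right hpg).1 (hpN.trans him)
    have hX0 : p ∣ X 0 := by
      rw [mul_assoc, hcu.dvd_mul_left] at h0
      rcases hp.dvd_or_dvd h0 with h | h
      · exact h2u.dvd_mul_left.1 (hp.dvd_of_dvd_pow h)
      · exact h
    refine not_dvd_X_zero_and_X_one hp hX0 (hp.dvd_of_dvd_pow (n := 2) ?_)
    rwa [normSq, dvd_add_right (dvd_pow hX0 two_ne_zero)] at hpN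
  · obtain ⟨n, u, hu, hn⟩ := WfDvdMonoid.max_power_factor hW0 hirr
    rcases n with _ | n
    · rw [pow_zero, one_mul] at hn
      exact hu (hn ▸ (hpf.mul_right _).sub (hpg.mul_right _))
    have hV : p ∣ imPow K m * rot K p := by
      refine dvd_mul_derivation_of_pow_dvd (rot K) hp hu (e := n) ?_
      rw [← hn, (isSolution_dihedralDer K m k).1.wronskian (isSolution_dihedralDer K m k).2]
      exact Dvd.dvd.mul_left (Dvd.intro _ hn.symm) _
    -- The Wronskian is homogeneous, so the Euler derivation also preserves its divisibility by
    -- powers of `p`, whence `p ∣ E p`. Together with `p ∣ rot p` this gives `p ∣ normSq * ∂p` for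
    -- both partial derivatives, and `p` would be constant.
    let E : PlaneDer K := (X 0 : MvPolynomial (Fin 2) K) • pderiv 0
      + (X 1 : MvPolynomial (Fin 2) K) • pderiv 1
    have hEapp : ∀ q, E q = X 0 * pderiv 0 q + X 1 * pderiv 1 q := fun q => rfl
    have hE : p ∣ 1 * E p := by
      refine dvd_mul_derivation_of_pow_dvd E hp hu (e := n) ?_
      have hhom : ∀ q : MvPolynomial (Fin 2) K, ∀ d, q.IsHomogeneous d →
          (rot K q).IsHomogeneous (d - 1 + 1) := by
        intro q d hq
        rw [rot_apply, add_comm]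
        exact ((isHomogeneous_X K 0).mul hq.pderiv).sub ((isHomogeneous_X K 1).mul hq.pderiv)
      have hθ := dihedralDer_isHomogeneous K m k
      have hWh := ((hθ 0).mul (hhom _ _ (hθ 1))).sub ((hθ 1).mul (hhom _ _ (hθ 0)))
      have hEu := hWh.sum_X_mul_pderiv
      rw [Fin.sum_univ_two, ← hEapp] at hEu
      rw [one_mul, ← hn, hEu, hn, nsmul_eq_mul]
      exact (Dvd.intro _ rfl : p ^ (n + 1) ∣ p ^ (n + 1) * u).mul_left _
    rw [one_mul, hEapp] at hE
    rcases hp.dvd_or_dvd hV with hY | hV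
    · obtain ⟨c, hc, hY'⟩ := hA.imPow_eq
      rw [hY', ((isUnit_iff_ne_zero.2 hc).map C).dvd_mul_left, hp.dvd_finsetProd_iff] at hY
      obtain ⟨i, -, hi⟩ := hY
      have has := (hp.associated_of_dvd (A.form_prime i) hi).symm.dvd
      exact hA.not_dvd_der_coeffs k i (has.trans hpf) (has.trans hpg)
    · rw [rot_apply] at hV
      have h0 : p ∣ pderiv 0 p := by
        refine (hp.dvd_or_dvd ?_).resolve_left hpN
        have := (hE.mul_left (X 0)).sub (hV.mul_left (X 1))
        convert this using 1
        rw [normSq]; ring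
      have h1 : p ∣ pderiv 1 p := by
        refine (hp.dvd_or_dvd ?_).resolve_left hpN
        have := (hE.mul_left (X 1)).add (hV.mul_left (X 0))
        convert this using 1
        rw [normSq]; ring
      have hpC := eq_C_of_pderiv_eq_zero (p := p) (by
        intro i
        fin_cases i
        · exact pderiv_eq_zero_of_dvd h0
        · exact pderiv_eq_zero_of_dvd h1)
      have hc0 : coeff 0 p ≠ 0 := by
        intro h; rw [h, C_0] at hpC; exact hp.ne_zero hpC
      exact hp.not_isUnit (by rw [hpC]; exact (isUnit_iff_ne_zero.2 hc0).map C)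

/-- The invariant derivation is central for the constant multiplicity `2 * k + 1`. -/
theorem isCentral (k : ℕ) :
    A.IsCentral (fun _ => 2 * k + 1) (dihedralDer K m k) (m * k + 1) where
  mem := A.mem_derModule.2 fun i => by
    obtain ⟨u, hu, -⟩ := hA.exists_der_form_eq k i
    exact Dvd.intro _ hu.symm
  homogeneous := dihedralDer_isHomogeneous K m k
  isRelPrime := hA.isRelPrime_der k
  not_dvd i h := by
    obtain ⟨u, hu, hiu⟩ := hA.exists_der_form_eq k i
    rw [hu, pow_succ, mul_dvd_mul_iff_left (pow_ne_zero _ (A.form_ne_zero i))] at h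
    exact hiu h

theorem component (hm : 2 < m) (k : ℕ) :
    (fun _ => 2 * k + 1) ∈ A.allMaxPoints ∧ ∃ C ∈ A.finiteComponents,
      A.maxPoints C = {fun _ => 2 * k + 1} ∧
      C = multBall (fun _ => 2 * k + 1) (A.Delta fun _ => 2 * k + 1) := by
  -- The radius comes from `m * (2 * k + 1) = 2 * (m * k + 1) + (m - 2)`.
  refine (hA.isCentral k).component (δ := m - 2) (by omega) ?_
  rw [Finset.sum_const, Finset.card_univ, hA.card, smul_eq_mul]
  obtain ⟨n, rfl⟩ := Nat.exists_eq_add_of_lt hm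
  rw [show 2 + n + 1 - 2 = n + 1 by omega]
  ring

end IsDihedral

end PlaneArrangement

/-! ### The arrangements of types `B₂` and `G₂`. -/

section Coxeter

open GaussPoly

variable {K : Type*} [Field K]

theorem not_dvd_normSq_of_eval {p : MvPolynomial (Fin 2) K} (v : Fin 2 → K) (h : eval v p = 0)
    (hv : v 0 ^ 2 + v 1 ^ 2 ≠ 0) : ¬ p ∣ normSq K := by
  rintro ⟨q, hq⟩
  have := congrArg (eval v) hq
  rw [eval_mul, h, zero_mul, normSq] at this
  simp at this
  exact hv this

variable [CharZero K]

theorem coxeterB2_isDihedral : (coxeterB2 K).IsDihedral 4 where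
  two_le := by norm_num
  card := rfl
  imPow_eq := by
    -- The imaginary part of `(x + i y) ^ 4` is `4 x y (x ^ 2 - y ^ 2)`.
    refine ⟨4, by norm_num, ?_⟩
    rw [Fin.prod_univ_four]
    have h4 : (C (4 : K) : MvPolynomial (Fin 2) K) = 4 := map_ofNat _ 4
    simp only [imPow, z, pow_succ, pow_zero, one_mul, QuadraticAlgebra.mk_mul_mk, h4]
    simp [coxeterB2]
    ring
  not_dvd i := by
    -- A direction vector of each line; its squared length is `1` or `2`.
    refine not_dvd_normSq_of_eval
      ((![![0, 1], ![1, 0], ![1, -1], ![1, 1]] : Fin 4 → Fin 2 → K) i) ?_ ?_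
    · fin_cases i <;> simp [coxeterB2]
    · fin_cases i <;> norm_num

theorem coxeterG2_isDihedral (s : K) (hs : s ^ 2 = 3) : (coxeterG2 K s hs).IsDihedral 6 where
  two_le := by norm_num
  card := rfl
  imPow_eq := by
    -- The imaginary part of `(x + i y) ^ 6` is `2 x y (x ^ 2 - 3 y ^ 2) (3 x ^ 2 - y ^ 2)`.
    refine ⟨2, by norm_num, ?_⟩
    have h2 : (C (2 : K) : MvPolynomial (Fin 2) K) = 2 := map_ofNat _ 2
    have h3 : (C s : MvPolynomial (Fin 2) K) ^ 2 = 3 := by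
      rw [← map_pow, hs]; exact map_ofNat _ 3
    rw [Fin.prod_univ_six]
    simp only [imPow, z, pow_succ, pow_zero, one_mul, QuadraticAlgebra.mk_mul_mk, h2]
    simp [coxeterG2]
    linear_combination (-2 * X 0 * X 1 * (X 0 ^ 4 + X 1 ^ 4
      - ((C s) ^ 2 + 3) * X 0 ^ 2 * X 1 ^ 2)) * h3
  not_dvd i := by
    refine not_dvd_normSq_of_eval
      ((![![0, 1], ![s, -1], ![s, 1], ![1, 0], ![1, -s], ![1, s]] : Fin 6 → Fin 2 → K) i) ?_ ?_
    · fin_cases i <;> simp [coxeterG2]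
    · fin_cases i <;> norm_num [hs]

end Coxeter

end

theorem proposition5p3 {K : Type*} [Field K] [CharZero K] (k : ℕ) :
    ((fun _ => 2 * k + 1) ∈ (coxeterB2 K).allMaxPoints ∧
      ∃ C ∈ (coxeterB2 K).finiteComponents,
        (coxeterB2 K).maxPoints C = {fun _ => 2 * k + 1} ∧
        C = multBall (fun _ => 2 * k + 1) ((coxeterB2 K).Delta fun _ => 2 * k + 1)) ∧
    (∀ (s : K) (hs : s ^ 2 = 3),
      (fun _ => 2 * k + 1) ∈ (coxeterG2 K s hs).allMaxPoints ∧
      ∃ C ∈ (coxeterG2 K s hs).finiteComponents,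
        (coxeterG2 K s hs).maxPoints C = {fun _ => 2 * k + 1} ∧
        C = multBall (fun _ => 2 * k + 1) ((coxeterG2 K s hs).Delta fun _ => 2 * k + 1)) :=
  ⟨coxeterB2_isDihedral.component (by norm_num) k,
    fun s hs => (coxeterG2_isDihedral s hs).component (by norm_num) k⟩
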